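/- Consider an $N$-level open quantum system with $\hbar>0$, Hermitian free Hamiltonian $H_0$, Hermitian control Hamiltonian $H_c(t)$ that is integrable and right-continuous on $[t_0,t_f]$ (for instance continuous), Lindblad operators $L_1,\dots,L_K\in\mathbb C^{N\times N}$ and decay rates $\gamma_k\ge 0$. For $\Omega\subset\mathbb R$ let $\mathcal U$ be the set of measurable, essentially bounded controls $u$ on $[t_0,t_f]$ with $u(t)\in\Omega$ for a.e. $t$. For $u\in\mathcal U$ the trajectory is the absolutely continuous $\rho$ on $[t_0,t_f]$ with $\rho(t_0)=\rho_0$, where $\rho_0$ is a given density matrix (Hermitian, positive semidefinite, of trace one), and, for a.e. $t$, $$\dot\rho=-\tfrac{i}{\hbar}[H_0+u(t)H_c(t),\rho]+\sum_k\gamma_k\big(L_k\rho L_k^\dagger-\tfrac12\{L_k^\dagger L_k,\rho\}\big).$$ Put $\delta_{jk}^{\mathrm{Re}}=|j\rangle\langle k|+|k\rangle\langle j|$, $\delta_{jk}^{\mathrm{Im}}=-i|j\rangle\langle k|+i|k\rangle\langle j|$, $\langle A\rangle_\rho=\mathrm{Tr}(\rho A)$, $$C(\rho)=\Big(\sum_{j<k}\langle\delta_{jk}^{\mathrm{Re}}\rangle_\rho^2+\langle\delta_{jk}^{\mathrm{Im}}\rangle_\rho^2\Big)^{1/2},\qquad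 \Phi(t,\rho)=-2i\sum_{j<k}\Big(\langle\delta_{jk}^{\mathrm{Re}}\rangle_\rho\langle[\delta_{jk}^{\mathrm{Re}},H_c(t)]\rangle_\rho+\langle\delta_{jk}^{\mathrm{Im}}\rangle_\rho\langle[\delta_{jk}^{\mathrm{Im}},H_c(t)]\rangle_\rho\Big).$$ Let $C^2(\rho_0)\in[\alpha,\beta]$ and $\varepsilon>0$. Then there is $M>0$ such that the following holds for every $\Omega\subset\mathbb R$ with $[-M,M]\subset\Omega$. Suppose that $|\Phi(t,\rho(t))|\ge\varepsilon$ for every trajectory $\rho$ of a control in $\mathcal U$ and every $t\in[t_0,t_f]$ such that $C^2(\rho(s))\in[\alpha,\beta]$ for all $s\in[t_0,t]$. Then the set $$\bar{\mathcal U}=\{u\in\mathcal U:\ C^2(\rho(t))\in[\alpha,\beta]\ \text{ for all } t\in[t_0,t_f]\}$$ is nonempty. If moreover $\Omega$ is a compact interval, then $\bar{\mathcal U}$ contains an optimal control $u^\star$, that is, one with $\int_{t_0}^{t_f}u^\star(t)^2\,dt\le\int_{t_0}^{t_f}u(t)^2\,dt$ for all $u\in\bar{\mathcal U}$. -/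

import Mathlib

open MeasureTheory Set
open scoped Matrix ComplexOrder

noncomputable section

/-- `N × N` complex matrices. -/
abbrev CMat (N : ℕ) : Type := Matrix (Fin N) (Fin N) ℂ

/-- Density matrices: Hermitian, positive semidefinite (`PosSemidef` contains both), trace one. -/
def IsDensityMatrix {N : ℕ} (ρ : CMat N) : Prop :=
  ρ.PosSemidef ∧ ρ.trace = 1

/-- The expectation value `⟨A⟩_ρ = Tr (ρ A)`. -/
def expVal {N : ℕ} (ρ A : CMat N) : ℂ := (ρ * A).trace

/-- `δ_{jk}^{Re} = |j⟩⟨k| + |k⟩⟨j|`. -/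
def deltaRe {N : ℕ} (j k : Fin N) : CMat N :=
  Matrix.single j k 1 + Matrix.single k j 1

/-- `δ_{jk}^{Im} = -i |j⟩⟨k| + i |k⟩⟨j|`. -/
def deltaIm {N : ℕ} (j k : Fin N) : CMat N :=
  Matrix.single j k (-Complex.I) + Matrix.single k j Complex.I

/-- The pairs `j < k` of levels. -/
def levelPairs (N : ℕ) : Finset (Fin N × Fin N) :=
  Finset.univ.filter fun p => p.1 < p.2

/-- The coherence function `C(ρ)`. The expectation values of the Hermitian operators
`deltaRe`, `deltaIm` in a Hermitian `ρ` are real, so taking real parts loses nothing. -/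
def coherence {N : ℕ} (ρ : CMat N) : ℝ :=
  Real.sqrt (∑ p ∈ levelPairs N,
    ((expVal ρ (deltaRe p.1 p.2)).re ^ 2 + (expVal ρ (deltaIm p.1 p.2)).re ^ 2))

/-- The function
`Φ = -2i ∑_{j<k} (⟨δ^{Re}⟩_ρ ⟨[δ^{Re}, H_c]⟩_ρ + ⟨δ^{Im}⟩_ρ ⟨[δ^{Im}, H_c]⟩_ρ)`. -/
def Phi {N : ℕ} (Hc ρ : CMat N) : ℂ :=
  -2 * Complex.I * ∑ p ∈ levelPairs N,
    (expVal ρ (deltaRe p.1 p.2) * expVal ρ ⁅deltaRe p.1 p.2, Hc⁆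
      + expVal ρ (deltaIm p.1 p.2) * expVal ρ ⁅deltaIm p.1 p.2, Hc⁆)

/-- A controlled open quantum system with `N` levels and `K` decoherence channels. -/
structure OpenSystem (N K : ℕ) where
  /-- reduced Planck constant -/
  hbar : ℝ
  hbar_pos : 0 < hbar
  /-- free Hamiltonian -/
  H₀ : CMat N
  H₀_herm : H₀.IsHermitian
  /-- control Hamiltonian; the total Hamiltonian is `H₀ + u(t) H_c(t)` -/
  Hc : ℝ → CMat N
  Hc_herm : ∀ t, (Hc t).IsHermitian
  /-- decay rates -/
  γ : Fin K → ℝ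
  γ_nonneg : ∀ k, 0 ≤ γ k
  /-- Lindblad operators -/
  L : Fin K → CMat N

namespace OpenSystem

variable {N K : ℕ} (S : OpenSystem N K)

/-- `𝓛(ρ) = ∑ₖ γₖ (Lₖ ρ Lₖ† - ½ {Lₖ† Lₖ, ρ})`. -/
def dissipator (ρ : CMat N) : CMat N :=
  ∑ k, (S.γ k : ℂ) • (S.L k * ρ * (S.L k)ᴴ
    - (1 / 2 : ℂ) • ((S.L k)ᴴ * S.L k * ρ + ρ * ((S.L k)ᴴ * S.L k)))

/-- Right-hand side of the Lindblad equation at time `t` with control value `v`: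
`-(i/ℏ) [H₀ + v H_c(t), ρ] + 𝓛(ρ)`. -/
def rhs (t v : ℝ) (ρ : CMat N) : CMat N :=
  (-(Complex.I / (S.hbar : ℂ))) • ⁅S.H₀ + (v : ℂ) • S.Hc t, ρ⁆ + S.dissipator ρ

/-- `ρ` is the state trajectory on `[t₀, t_f]` for the control `u` and initial state `ρ₀`:
absolutely continuous, with the Lindblad equation satisfied at almost every time
(entry by entry). -/
def IsTrajectory (t₀ tf : ℝ) (ρ₀ : CMat N) (u : ℝ → ℝ) (ρ : ℝ → CMat N) : Prop :=
  ρ t₀ = ρ₀ ∧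
  (∀ i j, AbsolutelyContinuousOnInterval (fun t => ρ t i j) t₀ tf) ∧
  ∀ᵐ t ∂(volume.restrict (Icc t₀ tf)),
    ∀ i j, HasDerivAt (fun s => ρ s i j) (S.rhs t (u t) (ρ t) i j) t

/-- The set `𝓤` of measurable, essentially bounded controls on `[t₀, t_f]` with values in `Ω`
almost everywhere. -/
def controls (t₀ tf : ℝ) (Ω : Set ℝ) : Set (ℝ → ℝ) :=
  {u | MemLp u ⊤ (volume.restrict (Icc t₀ tf)) ∧
    ∀ᵐ t ∂(volume.restrict (Icc t₀ tf)), u t ∈ Ω}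

/-- The controls in `𝓤` whose trajectory satisfies `C²(ρ(t)) ∈ [α, β]` for all
`t ∈ [t₀, t_f]`. -/
def feasibleControls (t₀ tf : ℝ) (ρ₀ : CMat N) (α β : ℝ) (Ω : Set ℝ) : Set (ℝ → ℝ) :=
  {u | u ∈ controls t₀ tf Ω ∧ ∃ ρ : ℝ → CMat N, S.IsTrajectory t₀ tf ρ₀ u ρ ∧
    ∀ t ∈ Icc t₀ tf, coherence (ρ t) ^ 2 ∈ Icc α β}

/-- `|Φ| ≥ ε` along all admissible trajectories, for as long as they respect the coherence
bounds. -/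
def PhiBoundedAway (t₀ tf : ℝ) (ρ₀ : CMat N) (α β : ℝ) (Ω : Set ℝ) (ε : ℝ) : Prop :=
  ∀ u ∈ controls t₀ tf Ω, ∀ ρ : ℝ → CMat N, S.IsTrajectory t₀ tf ρ₀ u ρ →
    ∀ t ∈ Icc t₀ tf, (∀ s ∈ Icc t₀ t, coherence (ρ s) ^ 2 ∈ Icc α β) →
      ε ≤ ‖Phi (S.Hc t) (ρ t)‖

end OpenSystem

/-- The energy `J(u) = ∫ u²` over `[t₀, t_f]`. -/
def controlEnergy (t₀ tf : ℝ) (u : ℝ → ℝ) : ℝ := ∫ t in t₀..tf, u t ^ 2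

end

/-
The commutator with a Hermitian matrix is skew-adjoint for the Frobenius inner product, so the norm
of a trajectory is bounded independently of the control. On Hermitian states `Φ / ℏ` is the
derivative of `C²` along the control field. Where `|Φ| ≥ ε`, the equation `d/dt C² = 0` can
therefore be solved for the control value, which is bounded because the states are; this bound
is `M`. With its denominator cut off away from zero, the resulting feedback is continuous in the
state, and Carathéodory's theorem gives a closed-loop trajectory. As long as `C²` keeps its initial
value, the hypothesis on `Φ` applies and bounds the gain away from the cut-off; since `H_c` is
right-continuous, this persists slightly longer, so `C²` is constant on all of `[t₀, t_f]`.

For the optimal control, a minimizing sequence has a weak-* limit `u`, and its trajectories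
converge uniformly along a subsequence. The equation is affine in the control, so the limit is a
trajectory of `u`. The coherence bounds are closed and `∫ u²` is weakly lower semicontinuous.
-/

section AbsoluteContinuity

open Filter Topology
open scoped RealInnerProductSpace

theorem absolutelyContinuousOnInterval_of_dist_le {X Y : Type*} [PseudoMetricSpace X]
    [PseudoMetricSpace Y] {f : ℝ → X} {g : ℝ → Y} {a b C : ℝ}
    (hg : AbsolutelyContinuousOnInterval g a b)
    (hfg : ∀ s ∈ uIcc a b, ∀ t ∈ uIcc a b, dist (f s) (f t) ≤ C * dist (g s) (g t)) :
    AbsolutelyContinuousOnInterval f a b := by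
  have hCg := Filter.Tendsto.const_mul C hg
  rw [mul_zero] at hCg
  refine squeeze_zero' (Eventually.of_forall fun I => Finset.sum_nonneg fun _ _ => dist_nonneg)
    ?_ hCg
  filter_upwards [mem_inf_of_right (mem_principal_self _)] with I hI
  rw [Finset.mul_sum]
  exact Finset.sum_le_sum fun i hi => hfg _ (hI.1 i hi).1 _ (hI.1 i hi).2

theorem absolutelyContinuousOnInterval_sum {ι F : Type*} [NormedAddCommGroup F] {a b : ℝ}
    (s : Finset ι) {f : ι → ℝ → F} (hf : ∀ i ∈ s, AbsolutelyContinuousOnInterval (f i) a b) :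
    AbsolutelyContinuousOnInterval (fun t => ∑ i ∈ s, f i t) a b := by
  classical
  induction s using Finset.induction_on with
  | empty =>
    simpa using (LipschitzWith.const (0 : F)).lipschitzOnWith.absolutelyContinuousOnInterval
      (a := a) (b := b)
  | insert i s hi ih =>
    simp only [Finset.sum_insert hi]
    exact (hf i (Finset.mem_insert_self i s)).fun_add
      (ih fun j hj => hf j (Finset.mem_insert_of_mem hj))

variable {E F : Type*} [NormedAddCommGroup E] [NormedSpace ℝ E]
  [NormedAddCommGroup F] [NormedSpace ℝ F] {a b : ℝ}

theorem absolutelyContinuousOnInterval_contDiff_comp {V : E → F} (hV : ContDiff ℝ 1 V)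
    {f : ℝ → E} (hf : AbsolutelyContinuousOnInterval f a b) :
    AbsolutelyContinuousOnInterval (fun t => V (f t)) a b := by
  obtain ⟨K, hK⟩ := hV.locallyLipschitz.locallyLipschitzOn.exists_lipschitzOnWith_of_compact
    (isCompact_uIcc.image_of_continuousOn hf.continuousOn)
  exact absolutelyContinuousOnInterval_of_dist_le hf fun s hs t ht =>
    hK.dist_le_mul _ (mem_image_of_mem f hs) _ (mem_image_of_mem f ht)

theorem absolutelyContinuousOnInterval_primitive {f : ℝ → E}
    (hf : IntervalIntegrable f volume a b) :
    AbsolutelyContinuousOnInterval (fun t => ∫ s in a..t, f s) a b := by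
  have hf_sub {t : ℝ} (ht : t ∈ uIcc a b) : IntervalIntegrable f volume a t :=
    hf.mono_set (uIcc_subset_uIcc_left ht)
  refine absolutelyContinuousOnInterval_of_dist_le (C := 1)
    (hf.norm.absolutelyContinuousOnInterval_intervalIntegral left_mem_uIcc) fun s hs t ht => ?_
  rw [one_mul, dist_eq_norm, Real.dist_eq,
    intervalIntegral.integral_interval_sub_left (hf_sub hs) (hf_sub ht),
    intervalIntegral.integral_interval_sub_left (hf_sub hs).norm (hf_sub ht).norm]
  exact intervalIntegral.norm_integral_le_abs_integral_norm

/-- `x` is absolutely continuous on `[a, b]` with almost everywhere derivative `x'`. This is the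
sense in which a Carathéodory solution satisfies its differential equation. -/
structure HasACDeriv (x x' : ℝ → E) (a b : ℝ) : Prop where
  absolutelyContinuous : AbsolutelyContinuousOnInterval x a b
  ae_hasDerivAt : ∀ᵐ t ∂volume.restrict (Icc a b), HasDerivAt x (x' t) t

namespace HasACDeriv

variable {x x' y y' : ℝ → E}

theorem continuousOn (h : HasACDeriv x x' a b) : ContinuousOn x (Icc a b) :=
  h.absolutelyContinuous.continuousOn.mono Icc_subset_uIcc

theorem mono (h : HasACDeriv x x' a b) {t : ℝ} (ht : t ∈ Icc a b) : HasACDeriv x x' a t where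
  absolutelyContinuous := h.absolutelyContinuous.mono
    (uIcc_subset_uIcc_left (Icc_subset_uIcc ht))
  ae_hasDerivAt :=
    ae_restrict_of_ae_restrict_of_subset (Icc_subset_Icc_right ht.2) h.ae_hasDerivAt

theorem congr_deriv (h : HasACDeriv x x' a b)
    (hx' : ∀ᵐ t ∂volume.restrict (Icc a b), x' t = y' t) :
    HasACDeriv x y' a b where
  absolutelyContinuous := h.absolutelyContinuous
  ae_hasDerivAt := by
    filter_upwards [h.ae_hasDerivAt, hx'] with t ht hxy
    exact hxy ▸ ht

theorem sub (hx : HasACDeriv x x' a b) (hy : HasACDeriv y y' a b) :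
    HasACDeriv (fun t => x t - y t) (fun t => x' t - y' t) a b where
  absolutelyContinuous := hx.absolutelyContinuous.fun_sub hy.absolutelyContinuous
  ae_hasDerivAt := by
    filter_upwards [hx.ae_hasDerivAt, hy.ae_hasDerivAt] with t hxt hyt using hxt.sub hyt

theorem sum {ι : Type*} (s : Finset ι) {x x' : ι → ℝ → E}
    (h : ∀ i ∈ s, HasACDeriv (x i) (x' i) a b) :
    HasACDeriv (fun t => ∑ i ∈ s, x i t) (fun t => ∑ i ∈ s, x' i t) a b where
  absolutelyContinuous :=
    absolutelyContinuousOnInterval_sum s fun i hi => (h i hi).absolutelyContinuous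
  ae_hasDerivAt := by
    filter_upwards [(Finset.eventually_all s).2 fun i hi => (h i hi).ae_hasDerivAt] with t ht
    exact HasDerivAt.fun_sum ht

theorem contDiff_comp {V : E → F} (hV : ContDiff ℝ 1 V) (h : HasACDeriv x x' a b) :
    HasACDeriv (fun t => V (x t)) (fun t => fderiv ℝ V (x t) (x' t)) a b where
  absolutelyContinuous := absolutelyContinuousOnInterval_contDiff_comp hV h.absolutelyContinuous
  ae_hasDerivAt := by
    filter_upwards [h.ae_hasDerivAt] with t ht
    exact (hV.differentiable one_ne_zero (x t)).hasFDerivAt.comp_hasDerivAt t ht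

theorem clm_comp (L : E →L[ℝ] F) (h : HasACDeriv x x' a b) :
    HasACDeriv (fun t => L (x t)) (fun t => L (x' t)) a b := by
  simpa only [L.fderiv] using h.contDiff_comp L.contDiff

theorem integral_eq_sub_real {f f' : ℝ → ℝ} (h : HasACDeriv f f' a b) (hab : a ≤ b) :
    ∫ t in a..b, f' t = f b - f a := by
  rw [← h.absolutelyContinuous.integral_deriv_eq_sub, intervalIntegral.integral_of_le hab,
    intervalIntegral.integral_of_le hab, ← integral_Icc_eq_integral_Ioc,
    ← integral_Icc_eq_integral_Ioc]
  exact integral_congr_ae (h.ae_hasDerivAt.mono fun t ht => ht.deriv.symm)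

theorem integral_eq_sub [CompleteSpace E] (h : HasACDeriv x x' a b) (hab : a ≤ b)
    (hx' : IntegrableOn x' (Icc a b)) : ∫ t in a..b, x' t = x b - x a := by
  have hx'_int := (intervalIntegrable_iff_integrableOn_Icc_of_le hab).2 hx'
  refine (SeparatingDual.eq_iff_forall_dual_eq (R := ℝ)).2 fun L => ?_
  rw [← L.intervalIntegral_comp_comm hx'_int, (h.clm_comp L).integral_eq_sub_real hab, map_sub]

theorem of_integral_eq [CompleteSpace E] {c : E} (hab : a ≤ b) (hx' : IntegrableOn x' (Icc a b))
    (hx : ∀ t ∈ Icc a b, x t = c + ∫ s in a..t, x' s) : HasACDeriv x x' a b where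
  absolutelyContinuous := by
    have hprim := absolutelyContinuousOnInterval_primitive
      ((intervalIntegrable_iff_integrableOn_Icc_of_le hab).2 hx')
    refine absolutelyContinuousOnInterval_of_dist_le (C := 1) hprim fun s hs t ht => ?_
    rw [uIcc_of_le hab] at hs ht
    rw [hx s hs, hx t ht, dist_add_left, one_mul]
  ae_hasDerivAt := by
    have hx'_int := (intervalIntegrable_iff_integrableOn_Icc_of_le hab).2 hx'
    rw [← Measure.restrict_congr_set Ioo_ae_eq_Icc, ae_restrict_iff' measurableSet_Ioo]
    filter_upwards [hx'_int.ae_hasDerivAt_integral] with t ht htab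
    have hprim := ht (Icc_subset_uIcc (Ioo_subset_Icc_self htab)) a left_mem_uIcc
    refine (hprim.const_add c).congr_of_eventuallyEq ?_
    filter_upwards [Ioo_mem_nhds htab.1 htab.2] with s hs using hx s (Ioo_subset_Icc_self hs)

-- Grönwall's inequality: `f t * exp (-C * (t - a))` has a nonpositive derivative.
theorem le_mul_exp {f f' : ℝ → ℝ} {C : ℝ} (h : HasACDeriv f f' a b)
    (hf' : ∀ᵐ t ∂volume.restrict (Icc a b), f' t ≤ C * f t) {t : ℝ} (ht : t ∈ Icc a b) :
    f t ≤ f a * Real.exp (C * (t - a)) := by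
  have hexp_deriv (s : ℝ) : HasDerivAt (fun s => Real.exp (-C * (s - a)))
      (Real.exp (-C * (s - a)) * -C) s := by
    simpa using (((hasDerivAt_id s).sub_const a).const_mul (-C)).exp
  have hexp : AbsolutelyContinuousOnInterval (fun s => Real.exp (-C * (s - a))) a t :=
    ContDiffOn.absolutelyContinuousOnInterval (by fun_prop)
  have hprod : HasACDeriv (fun s => f s * Real.exp (-C * (s - a)))
      (fun s => (f' s - C * f s) * Real.exp (-C * (s - a))) a t := by
    refine ⟨(h.mono ht).absolutelyContinuous.fun_mul hexp, ?_⟩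
    filter_upwards [(h.mono ht).ae_hasDerivAt] with s hs
    exact (hs.fun_mul (hexp_deriv s)).congr_deriv (by ring)
  have hdecr : f t * Real.exp (-C * (t - a)) - f a * Real.exp (-C * (a - a)) ≤ 0 := by
    rw [← hprod.integral_eq_sub_real ht.1, intervalIntegral.integral_of_le ht.1,
      ← integral_Icc_eq_integral_Ioc]
    refine integral_nonpos_of_ae ?_
    filter_upwards [ae_restrict_of_ae_restrict_of_subset (Icc_subset_Icc_right ht.2) hf']
      with s hs using mul_nonpos_of_nonpos_of_nonneg (sub_nonpos.2 hs) (Real.exp_pos _).le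
  calc f t = f t * Real.exp (-C * (t - a)) * Real.exp (C * (t - a)) := by
        rw [mul_assoc, ← Real.exp_add]; simp
    _ ≤ f a * Real.exp (C * (t - a)) := by
        gcongr
        simpa using hdecr

end HasACDeriv

theorem HasACDeriv.norm_le_mul_exp {E : Type*} [NormedAddCommGroup E] [InnerProductSpace ℝ E]
    {x x' : ℝ → E} {C : ℝ} (h : HasACDeriv x x' a b)
    (hx' : ∀ᵐ t ∂volume.restrict (Icc a b), ⟪x t, x' t⟫ ≤ C * ‖x t‖ ^ 2) {t : ℝ}
    (ht : t ∈ Icc a b) : ‖x t‖ ≤ ‖x a‖ * Real.exp (C * (t - a)) := by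
  have hsq : ‖x t‖ ^ 2 ≤ ‖x a‖ ^ 2 * Real.exp (2 * C * (t - a)) := by
    refine (h.contDiff_comp (contDiff_norm_sq ℝ)).le_mul_exp ?_ ht
    filter_upwards [hx'] with s hs
    simp only [fderiv_norm_sq_apply, smul_apply, innerSL_apply_apply, nsmul_eq_mul]
    push_cast
    linarith
  refine le_of_sq_le_sq ?_ (by positivity)
  rwa [mul_pow, ← Real.exp_nat_mul, Nat.cast_ofNat, ← mul_assoc]

end AbsoluteContinuity

section Compactness

open Filter Topology

/- Arzelà–Ascoli: domination of all increments by those of one continuous function is a form of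
equicontinuity. -/
theorem exists_subseq_tendsto_of_dist_le_dist {X Y E : Type*} [TopologicalSpace X] [CompactSpace X]
    [PseudoMetricSpace Y] [MetricSpace E] {K : Set E} (hK : IsCompact K) {G : X → Y}
    (hG : Continuous G) {x : ℕ → X → E} (hxK : ∀ n t, x n t ∈ K)
    (hx : ∀ n s t, dist (x n s) (x n t) ≤ dist (G s) (G t)) :
    ∃ (y : X → E) (φ : ℕ → ℕ), Continuous y ∧ StrictMono φ ∧
      ∀ t, Tendsto (fun n => x (φ n) t) atTop (𝓝 (y t)) := by
  have hG_dist (s : X) : Tendsto (fun t => dist (G s) (G t)) (𝓝 s) (𝓝 0) := by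
    simpa using (tendsto_const_nhds (x := G s)).dist (hG.tendsto s)
  have hx_cont (n : ℕ) : Continuous (x n) := continuous_iff_continuousAt.2 fun s =>
    tendsto_iff_dist_tendsto_zero.2 <| squeeze_zero (fun _ => dist_nonneg)
      (fun t => dist_comm (x n t) _ ▸ hx n s t) (hG_dist s)
  let X' : ℕ → BoundedContinuousFunction X E := fun n =>
    BoundedContinuousFunction.mkOfCompact ⟨x n, hx_cont n⟩
  have hcompact : IsCompact (closure (range X')) := by
    refine BoundedContinuousFunction.arzela_ascoli K hK (range X') ?_ fun s => ?_
    · rintro _ t ⟨n, rfl⟩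
      exact hxK n t
    · refine Metric.equicontinuousAt_iff_right.2 fun ε hε => ?_
      filter_upwards [(hG_dist s).eventually_lt_const hε] with t ht
      rintro ⟨_, n, rfl⟩
      exact (hx n s t).trans_lt ht
  obtain ⟨y, -, φ, hφ, hy⟩ := hcompact.isSeqCompact fun n => subset_closure (mem_range_self n)
  exact ⟨y, φ, y.continuous, hφ, fun t => ((continuous_eval_const t).tendsto y).comp hy⟩

theorem exists_subseq_tendsto_of_dist_le_dist_Icc {E : Type*} [MetricSpace E] [ProperSpace E]
    {a b : ℝ} {G : ℝ → ℝ} {x : ℕ → ℝ → E} (hab : a ≤ b) (hG : ContinuousOn G (Icc a b))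
    {x₀ : E} (hxa : ∀ n, x n a = x₀)
    (hx : ∀ n, ∀ s ∈ Icc a b, ∀ t ∈ Icc a b, dist (x n s) (x n t) ≤ dist (G s) (G t)) :
    ∃ (y : ℝ → E) (φ : ℕ → ℕ), Continuous y ∧ StrictMono φ ∧
      ∀ t ∈ Icc a b, Tendsto (fun n => x (φ n) t) atTop (𝓝 (y t)) := by
  obtain ⟨C, hC⟩ := isCompact_Icc.exists_bound_of_continuousOn
    (f := fun t => dist (G t) (G a))
    (continuous_dist.comp_continuousOn (hG.prodMk continuousOn_const))
  have hmem (n : ℕ) (t : Icc a b) : x n t ∈ Metric.closedBall x₀ C := by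
    rw [Metric.mem_closedBall, ← hxa n]
    exact (hx n t t.2 a (left_mem_Icc.2 hab)).trans ((Real.le_norm_self _).trans (hC t t.2))
  obtain ⟨y, φ, hy, hφ, hlim⟩ := exists_subseq_tendsto_of_dist_le_dist
    (isCompact_closedBall x₀ C) hG.domRestrict (x := fun n (t : Icc a b) => x n t) hmem
    fun n s t => hx n s s.2 t t.2
  refine ⟨IccExtend hab y, φ, hy.Icc_extend', hφ, fun t ht => ?_⟩
  rw [IccExtend_of_mem _ _ ht]
  exact hlim ⟨t, ht⟩

theorem tendsto_apply_of_dist_le_dist {X Y E : Type*} [TopologicalSpace X] [PseudoMetricSpace Y]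
    [PseudoMetricSpace E] {G : X → Y} {S : Set X} {s : X} (hG : ContinuousWithinAt G S s)
    {x : ℕ → X → E} (hs : s ∈ S)
    (hx : ∀ n, ∀ r ∈ S, ∀ t ∈ S, dist (x n r) (x n t) ≤ dist (G r) (G t)) {z : E}
    (hxs : Tendsto (fun n => x n s) atTop (𝓝 z)) {τ : ℕ → X} (hτS : ∀ n, τ n ∈ S)
    (hτ : Tendsto τ atTop (𝓝 s)) : Tendsto (fun n => x n (τ n)) atTop (𝓝 z) := by
  have hGτ : Tendsto (fun n => dist (G s) (G (τ n))) atTop (𝓝 0) := by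
    simpa using (tendsto_const_nhds (x := G s)).dist (hG.tendsto.comp (tendsto_nhdsWithin_iff.2
      ⟨hτ, Eventually.of_forall hτS⟩))
  exact (tendsto_iff_of_dist <| squeeze_zero (fun _ => dist_nonneg)
    (fun n => hx n s hs (τ n) (hτS n)) hGτ).1 hxs

end Compactness

section Caratheodory

open Filter Topology

variable {E : Type*} [NormedAddCommGroup E]
  {μ : Measure ℝ} {f : ℝ → E → E} {m : ℝ → ℝ} {a b h : ℝ} {x₀ : E} {x : ℝ → E}

/-- Carathéodory's conditions on the right-hand side `f` of a differential equation, with an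
integrable majorant `m`. Measurability in time is only asked for along continuous curves, which
spares the application a joint measurability argument. -/
structure IsCaratheodory (μ : Measure ℝ) (f : ℝ → E → E) (m : ℝ → ℝ) : Prop where
  ae_continuous : ∀ᵐ t ∂μ, Continuous (f t)
  aestronglyMeasurable : ∀ x : ℝ → E, Continuous x → AEStronglyMeasurable (fun t => f t (x t)) μ
  integrable_majorant : Integrable m μ
  ae_norm_le : ∀ᵐ t ∂μ, ∀ x, ‖f t x‖ ≤ m t

namespace IsCaratheodory

theorem integrable_comp (hf : IsCaratheodory μ f m) (hx : Continuous x) :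
    Integrable (fun t => f t (x t)) μ :=
  hf.integrable_majorant.mono' (hf.aestronglyMeasurable x hx)
    (hf.ae_norm_le.mono fun _ ht => ht _)

theorem integrable_comp_delay (hf : IsCaratheodory μ f m) (hx : Continuous x) :
    Integrable (fun s => f s (x (max a (s - h)))) μ :=
  hf.integrable_comp (x := fun s => x (max a (s - h))) (by fun_prop)

end IsCaratheodory

variable [NormedSpace ℝ E]

/-- The Picard operator of the differential equation `x' = f t x`, `x a = x₀`, with the argument
of `f` delayed by `h`. Its fixed points are Tonelli's approximate solutions. -/
noncomputable def tonelliOperator (μ : Measure ℝ) (f : ℝ → E → E) (a h : ℝ) (x₀ : E)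
    (x : ℝ → E) (t : ℝ) : E :=
  x₀ + ∫ s in a..t, f s (x (max a (s - h))) ∂μ

theorem tonelliOperator_self : tonelliOperator μ f a h x₀ x a = x₀ := by
  simp [tonelliOperator]

theorem tonelliOperator_eqOn {x y : ℝ → E} {c : ℝ} (hc : a ≤ c)
    (hxy : EqOn x y (Icc a c)) :
    EqOn (tonelliOperator μ f a h x₀ x) (tonelliOperator μ f a h x₀ y) (Icc a (c + h)) := by
  intro t ht
  refine congrArg (x₀ + ·) (intervalIntegral.integral_congr fun s hs => ?_)
  rw [uIcc_of_le ht.1] at hs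
  have hdelay : max a (s - h) ∈ Icc a c :=
    ⟨le_max_left _ _, max_le hc (by linarith [hs.2, ht.2])⟩
  simp only [hxy hdelay]

theorem iterate_tonelliOperator_eqOn (hh : 0 ≤ h) (k : ℕ) :
    EqOn ((tonelliOperator μ f a h x₀)^[k + 1] fun _ => x₀)
      ((tonelliOperator μ f a h x₀)^[k] fun _ => x₀) (Icc a (a + k * h)) := by
  induction k with
  | zero =>
    intro t ht
    obtain rfl : t = a := by simpa using ht
    simp [tonelliOperator_self]
  | succ k ih =>
    have hk : a + (k + 1 : ℕ) * h = a + k * h + h := by push_cast; ring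
    have hstep := tonelliOperator_eqOn (μ := μ) (f := f) (h := h) (x₀ := x₀)
      (le_add_of_nonneg_right (by positivity)) ih
    rw [← hk] at hstep
    simpa only [Function.iterate_succ', Function.comp_apply] using hstep

namespace IsCaratheodory

theorem continuous_tonelliOperator [NullSingletonClass μ] (hf : IsCaratheodory μ f m)
    (hx : Continuous x) :
    Continuous (tonelliOperator μ f a h x₀ x) :=
  continuous_const.add <| intervalIntegral.continuous_primitive
    (fun _ _ => (hf.integrable_comp_delay hx).intervalIntegrable) a

theorem dist_tonelliOperator_le (hf : IsCaratheodory μ f m) (hx : Continuous x) (s t : ℝ) :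
    dist (tonelliOperator μ f a h x₀ x s) (tonelliOperator μ f a h x₀ x t) ≤
      dist (∫ r in a..s, m r ∂μ) (∫ r in a..t, m r ∂μ) := by
  have hfx {c d : ℝ} := (hf.integrable_comp_delay (a := a) (h := h) hx).intervalIntegrable
    (a := c) (b := d)
  have hm {c d : ℝ} := hf.integrable_majorant.intervalIntegrable (a := c) (b := d)
  rw [tonelliOperator, tonelliOperator, dist_add_left, dist_eq_norm, Real.dist_eq,
    intervalIntegral.integral_interval_sub_left hfx hfx,
    intervalIntegral.integral_interval_sub_left hm hm]
  exact intervalIntegral.norm_integral_le_abs_of_norm_le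
    (ae_restrict_of_ae (hf.ae_norm_le.mono fun _ hr => hr _)) hm

theorem exists_tonelliOperator_eqOn [NullSingletonClass μ] (hf : IsCaratheodory μ f m) (a b : ℝ)
    (hh : 0 < h) (x₀ : E) :
    ∃ x : ℝ → E, Continuous x ∧ EqOn x (tonelliOperator μ f a h x₀ x) (Icc a b) := by
  obtain ⟨k, hk⟩ := exists_nat_ge ((b - a) / h)
  rw [div_le_iff₀ hh] at hk
  refine ⟨(tonelliOperator μ f a h x₀)^[k] fun _ => x₀, ?_, fun t ht => ?_⟩
  · exact Function.Iterate.rec (fun x : ℝ → E => Continuous x) continuous_const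
      (fun _ hx => hf.continuous_tonelliOperator hx) k
  · rw [← Function.iterate_succ_apply' (tonelliOperator μ f a h x₀)]
    exact (iterate_tonelliOperator_eqOn hh.le k ⟨ht.1, by linarith [ht.2]⟩).symm

theorem tendsto_integral (hf : IsCaratheodory μ f m) {x : ℕ → ℝ → E} {y : ℝ → E}
    (hx : ∀ n, Continuous (x n)) {c d : ℝ}
    (hxy : ∀ t ∈ uIoc c d, Tendsto (fun n => x n t) atTop (𝓝 (y t))) :
    Tendsto (fun n => ∫ t in c..d, f t (x n t) ∂μ) atTop (𝓝 (∫ t in c..d, f t (y t) ∂μ)) := by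
  refine intervalIntegral.tendsto_integral_filter_of_dominated_convergence m
    (Eventually.of_forall fun n => (hf.aestronglyMeasurable _ (hx n)).restrict)
    (Eventually.of_forall fun n => hf.ae_norm_le.mono fun t ht _ => ht _)
    hf.integrable_majorant.intervalIntegrable ?_
  filter_upwards [hf.ae_continuous] with t ht htcd using (ht.tendsto _).comp (hxy t htcd)

/- Carathéodory's existence theorem. Tonelli's approximate solutions have equicontinuous increments,
and a locally uniform limit of them solves the equation without delay. -/
theorem exists_integral_eq [ProperSpace E] [NullSingletonClass μ] (hf : IsCaratheodory μ f m)
    (hab : a ≤ b) (x₀ : E) :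
    ∃ y : ℝ → E, Continuous y ∧ ∀ t ∈ Icc a b, y t = x₀ + ∫ s in a..t, f s (y s) ∂μ := by
  let h : ℕ → ℝ := fun n => 1 / (n + 1)
  have hh_pos (n : ℕ) : 0 < h n := Nat.one_div_pos_of_nat
  choose x hx_cont hx using fun n => hf.exists_tonelliOperator_eqOn a b (hh_pos n) x₀
  let G : ℝ → ℝ := fun t => ∫ s in a..t, m s ∂μ
  have hG : Continuous G := intervalIntegral.continuous_primitive
    (fun _ _ => hf.integrable_majorant.intervalIntegrable) a
  have hxG (n : ℕ) : ∀ s ∈ Icc a b, ∀ t ∈ Icc a b, dist (x n s) (x n t) ≤ dist (G s) (G t) := by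
    intro s hs t ht
    rw [hx n hs, hx n ht]
    exact hf.dist_tonelliOperator_le (hx_cont n) s t
  obtain ⟨y, φ, hy, hφ, hlim⟩ := exists_subseq_tendsto_of_dist_le_dist_Icc hab hG.continuousOn
    (fun n => (hx n (left_mem_Icc.2 hab)).trans tonelliOperator_self) hxG
  have hdelay : ∀ s ∈ Icc a b,
      Tendsto (fun n => x (φ n) (max a (s - h (φ n)))) atTop (𝓝 (y s)) := by
    intro s hs
    refine tendsto_apply_of_dist_le_dist hG.continuousWithinAt hs (fun n => hxG (φ n)) (hlim s hs)
      (fun n => ⟨le_max_left _ _, max_le hab (by linarith [hs.2, hh_pos (φ n)])⟩) ?_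
    have hhφ : Tendsto (fun n => h (φ n)) atTop (𝓝 0) :=
      tendsto_one_div_add_atTop_nhds_zero_nat.comp hφ.tendsto_atTop
    simpa [hs.1] using (tendsto_const_nhds (x := a)).max (hhφ.const_sub s)
  refine ⟨y, hy, fun t ht => tendsto_nhds_unique (hlim t ht) ?_⟩
  have h_int := hf.tendsto_integral (c := a) (d := t)
    (x := fun n s => x (φ n) (max a (s - h (φ n))))
    (fun n => (hx_cont (φ n)).comp (by fun_prop)) fun s hs => by
      rw [uIoc_of_le ht.1] at hs
      exact hdelay s ⟨hs.1.le, hs.2.trans ht.2⟩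
  exact (h_int.const_add x₀).congr fun n => (hx (φ n) ht).symm

end IsCaratheodory

end Caratheodory

section WeakStar

open Filter Topology
open scoped RealInnerProductSpace

theorem exists_subseq_tendsto_inner {H : Type*} [NormedAddCommGroup H] [InnerProductSpace ℝ H]
    [CompleteSpace H] [TopologicalSpace.SeparableSpace H] {B : ℝ} {x : ℕ → H}
    (hx : ∀ n, ‖x n‖ ≤ B) :
    ∃ (w : H) (φ : ℕ → ℕ), StrictMono φ ∧
      ∀ y, Tendsto (fun n => ⟪x (φ n), y⟫) atTop (𝓝 ⟪w, y⟫) := by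
  let D : ℕ → WeakDual ℝ H := fun n =>
    StrongDual.toWeakDual (InnerProductSpace.toDual ℝ H (x n))
  have hD (n : ℕ) : D n ∈ WeakDual.toStrongDual ⁻¹' Metric.closedBall (0 : StrongDual ℝ H) B := by
    rw [mem_preimage, mem_closedBall_zero_iff]
    exact ((InnerProductSpace.toDual ℝ H).norm_map (x n)).trans_le (hx n)
  obtain ⟨ℓ, -, φ, hφ, hℓ⟩ := WeakDual.isSeqCompact_closedBall ℝ H 0 B hD
  refine ⟨(InnerProductSpace.toDual ℝ H).symm (WeakDual.toStrongDual ℓ), φ, hφ, fun y => ?_⟩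
  rw [InnerProductSpace.toDual_symm_apply]
  exact ((WeakDual.eval_continuous y).tendsto ℓ).comp hℓ

variable {α : Type*} [MeasurableSpace α] {μ : Measure α} {u : ℕ → α → ℝ} {v : α → ℝ} {C : ℝ}

/-- Weak-* convergence in `L^∞` of a uniformly bounded sequence of real functions, tested on
measurable sets only; `TendstoWeakStar.tendsto_integral_smul` extends it to integrable functions. -/
structure TendstoWeakStar (μ : Measure α) (u : ℕ → α → ℝ) (v : α → ℝ) (C : ℝ) : Prop where
  aestronglyMeasurable : ∀ n, AEStronglyMeasurable (u n) μ
  ae_norm_le : ∀ n, ∀ᵐ t ∂μ, ‖u n t‖ ≤ C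
  aestronglyMeasurable_limit : AEStronglyMeasurable v μ
  ae_norm_limit_le : ∀ᵐ t ∂μ, ‖v t‖ ≤ C
  tendsto_setIntegral : ∀ s, MeasurableSet s → μ s < ⊤ →
    Tendsto (fun n => ∫ t in s, u n t ∂μ) atTop (𝓝 (∫ t in s, v t ∂μ))

theorem exists_subseq_tendsto_setIntegral [IsSeparable μ] [IsFiniteMeasure μ]
    (hu : ∀ n, AEStronglyMeasurable (u n) μ) (hC : ∀ n, ∀ᵐ t ∂μ, ‖u n t‖ ≤ C) :
    ∃ (v : α → ℝ) (φ : ℕ → ℕ), Integrable v μ ∧ StrictMono φ ∧ ∀ s, MeasurableSet s →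
      Tendsto (fun n => ∫ t in s, u (φ n) t ∂μ) atTop (𝓝 (∫ t in s, v t ∂μ)) := by
  have : Fact ((1 : ENNReal) ≤ 2) := ⟨one_le_two⟩
  have : Fact ((2 : ENNReal) ≠ ⊤) := ⟨ENNReal.ofNat_ne_top⟩
  have hmem (n : ℕ) : MemLp (u n) 2 μ := MemLp.of_bound (hu n) C (hC n)
  have hbound (n : ℕ) : ‖(hmem n).toLp (u n)‖ ≤ μ.real univ ^ (2 : ENNReal).toReal⁻¹ * max C 0 :=
    Lp.norm_le_of_ae_bound (le_max_right C 0) <| by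
      filter_upwards [hC n, (hmem n).coeFn_toLp] with t ht htu
      exact htu ▸ ht.trans (le_max_left C 0)
  obtain ⟨w, φ, hφ, hw⟩ := exists_subseq_tendsto_inner hbound
  refine ⟨w, φ, (Lp.memLp w).integrable one_le_two, hφ, fun s hs => ?_⟩
  have hinner (f : Lp ℝ 2 μ) :
      ⟪f, indicatorConstLp 2 hs (measure_ne_top μ s) (1 : ℝ)⟫ = ∫ t in s, f t ∂μ := by
    rw [real_inner_comm]
    exact L2.inner_indicatorConstLp_one hs (measure_ne_top μ s) f
  have hlim := hw (indicatorConstLp 2 hs (measure_ne_top μ s) (1 : ℝ))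
  rw [hinner] at hlim
  refine hlim.congr fun n => (hinner _).trans ?_
  exact integral_congr_ae (ae_restrict_of_ae (hmem (φ n)).coeFn_toLp)

theorem ae_mem_Icc_of_tendsto_setIntegral [IsFiniteMeasure μ] {a b : ℝ}
    (hu : ∀ n, Integrable (u n) μ) (huab : ∀ n, ∀ᵐ t ∂μ, u n t ∈ Icc a b) (hv : Integrable v μ)
    (huv : ∀ s, MeasurableSet s →
      Tendsto (fun n => ∫ t in s, u n t ∂μ) atTop (𝓝 (∫ t in s, v t ∂μ))) :
    ∀ᵐ t ∂μ, v t ∈ Icc a b := by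
  have hav : (fun _ => a) ≤ᵐ[μ] v :=
    ae_le_of_forall_setIntegral_le (integrable_const a) hv fun s hs _ =>
      ge_of_tendsto' (huv s hs) fun n => integral_mono_ae (integrable_const a) (hu n).integrableOn
        (ae_restrict_of_ae ((huab n).mono fun _ ht => ht.1))
  have hvb : v ≤ᵐ[μ] fun _ => b :=
    ae_le_of_forall_setIntegral_le hv (integrable_const b) fun s hs _ =>
      le_of_tendsto' (huv s hs) fun n => integral_mono_ae (hu n).integrableOn (integrable_const b)
        (ae_restrict_of_ae ((huab n).mono fun _ ht => ht.2))
  filter_upwards [hav, hvb] with t hat hbt using ⟨hat, hbt⟩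

theorem exists_subseq_tendstoWeakStar [IsSeparable μ] [IsFiniteMeasure μ] {a b : ℝ}
    (hu : ∀ n, AEStronglyMeasurable (u n) μ) (huab : ∀ n, ∀ᵐ t ∂μ, u n t ∈ Icc a b) :
    ∃ (v : α → ℝ) (φ : ℕ → ℕ), StrictMono φ ∧ (∀ᵐ t ∂μ, v t ∈ Icc a b) ∧
      TendstoWeakStar μ (fun n => u (φ n)) v (max |a| |b|) := by
  have hC (n : ℕ) : ∀ᵐ t ∂μ, ‖u n t‖ ≤ max |a| |b| :=
    (huab n).mono fun t ht => abs_le_max_abs_abs ht.1 ht.2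
  obtain ⟨v, φ, hv, hφ, huv⟩ := exists_subseq_tendsto_setIntegral hu hC
  have hvab := ae_mem_Icc_of_tendsto_setIntegral
    (fun n => Integrable.of_bound (hu (φ n)) _ (hC (φ n))) (fun n => huab (φ n)) hv huv
  exact ⟨v, φ, hφ, hvab, fun n => hu (φ n), fun n => hC (φ n), hv.1,
    hvab.mono fun t ht => abs_le_max_abs_abs ht.1 ht.2, fun s hs _ => huv s hs⟩

namespace TendstoWeakStar

theorem subseq (h : TendstoWeakStar μ u v C) {φ : ℕ → ℕ} (hφ : StrictMono φ) :
    TendstoWeakStar μ (fun n => u (φ n)) v C where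
  aestronglyMeasurable n := h.aestronglyMeasurable (φ n)
  ae_norm_le n := h.ae_norm_le (φ n)
  aestronglyMeasurable_limit := h.aestronglyMeasurable_limit
  ae_norm_limit_le := h.ae_norm_limit_le
  tendsto_setIntegral s hs hμs := (h.tendsto_setIntegral s hs hμs).comp hφ.tendsto_atTop

theorem restrict [IsFiniteMeasure μ] (h : TendstoWeakStar μ u v C) {S : Set α}
    (hS : MeasurableSet S) : TendstoWeakStar (μ.restrict S) u v C where
  aestronglyMeasurable n := (h.aestronglyMeasurable n).restrict
  ae_norm_le n := ae_restrict_of_ae (h.ae_norm_le n)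
  aestronglyMeasurable_limit := h.aestronglyMeasurable_limit.restrict
  ae_norm_limit_le := ae_restrict_of_ae h.ae_norm_limit_le
  tendsto_setIntegral s hs _ := by
    simp only [Measure.restrict_restrict hs]
    exact h.tendsto_setIntegral _ (hs.inter hS) (measure_lt_top μ _)

end TendstoWeakStar

variable {E : Type*} [NormedAddCommGroup E] [NormedSpace ℝ E]

theorem integral_smul_add {w : α → ℝ} {f g : α → E} (hw : AEStronglyMeasurable w μ)
    (hwC : ∀ᵐ t ∂μ, ‖w t‖ ≤ C) (hf : Integrable f μ) (hg : Integrable g μ) :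
    ∫ t, w t • (f t + g t) ∂μ = (∫ t, w t • f t ∂μ) + ∫ t, w t • g t ∂μ := by
  simp_rw [smul_add]
  exact integral_add (hf.bdd_smul C hw hwC) (hg.bdd_smul C hw hwC)

theorem lipschitzWith_integral_smul {w : α → ℝ} (hw : AEStronglyMeasurable w μ)
    (hwC : ∀ᵐ t ∂μ, ‖w t‖ ≤ C) :
    LipschitzWith C.toNNReal fun f : α →₁[μ] E => ∫ t, w t • f t ∂μ := by
  refine LipschitzWith.of_dist_le_mul fun f g => ?_
  have h_int (f : α →₁[μ] E) : Integrable (fun t => w t • f t) μ :=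
    (L1.integrable_coeFn f).bdd_smul C hw hwC
  rw [dist_eq_norm, ← integral_sub (h_int f) (h_int g), dist_eq_norm, L1.norm_eq_integral_norm,
    ← integral_const_mul]
  refine norm_integral_le_of_norm_le ((L1.integrable_coeFn (f - g)).norm.const_mul _) ?_
  filter_upwards [hwC, Lp.coeFn_sub f g] with t ht hfg
  rw [hfg, Pi.sub_apply, ← smul_sub, norm_smul]
  gcongr
  exact ht.trans (Real.le_coe_toNNReal C)

namespace TendstoWeakStar

theorem tendsto_integral_smul [CompleteSpace E] (h : TendstoWeakStar μ u v C) {g : α → E}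
    (hg : Integrable g μ) :
    Tendsto (fun n => ∫ t, u n t • g t ∂μ) atTop (𝓝 (∫ t, v t • g t ∂μ)) := by
  refine Integrable.induction (fun g : α → E =>
    Tendsto (fun n => ∫ t, u n t • g t ∂μ) atTop (𝓝 (∫ t, v t • g t ∂μ))) ?_ ?_ ?_ ?_ hg
  · intro c s hs hμs
    have h_int (w : α → ℝ) : ∫ t, w t • s.indicator (fun _ => c) t ∂μ = (∫ t in s, w t ∂μ) • c := by
      rw [← integral_smul_const, ← integral_indicator hs]
      exact integral_congr_ae (ae_of_all _ fun t => (indicator_smul_apply s w (fun _ => c) t).symm)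
    simp_rw [h_int]
    exact (h.tendsto_setIntegral s hs hμs).smul_const c
  · intro f g _ hf hg ihf ihg
    simp only [Pi.add_apply]
    rw [integral_smul_add h.aestronglyMeasurable_limit h.ae_norm_limit_le hf hg]
    exact (ihf.add ihg).congr fun n =>
      (integral_smul_add (h.aestronglyMeasurable n) (h.ae_norm_le n) hf hg).symm
  · have hlip (n : ℕ) := lipschitzWith_integral_smul (E := E) (h.aestronglyMeasurable n)
      (h.ae_norm_le n)
    exact (LipschitzWith.uniformEquicontinuous _ _ hlip).equicontinuous.isClosed_setOfPred_tendsto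
      (lipschitzWith_integral_smul h.aestronglyMeasurable_limit h.ae_norm_limit_le).continuous
  · intro f g hfg _ ihf
    have hcongr (w : α → ℝ) : ∫ t, w t • f t ∂μ = ∫ t, w t • g t ∂μ :=
      integral_congr_ae (hfg.mono fun t ht => by simp only [ht])
    simpa only [hcongr] using ihf

theorem tendsto_integral_smul_of_dominated [CompleteSpace E] (h : TendstoWeakStar μ u v C)
    {g : ℕ → α → E} {g' : α → E} {m : α → ℝ} (hg : ∀ n, AEStronglyMeasurable (g n) μ)
    (hg' : AEStronglyMeasurable g' μ) (hm : Integrable m μ) (hgm : ∀ n, ∀ᵐ t ∂μ, ‖g n t‖ ≤ m t)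
    (hlim : ∀ᵐ t ∂μ, Tendsto (fun n => g n t) atTop (𝓝 (g' t))) :
    Tendsto (fun n => ∫ t, u n t • g n t ∂μ) atTop (𝓝 (∫ t, v t • g' t ∂μ)) := by
  have hg_int (n : ℕ) : Integrable (g n) μ := hm.mono' (hg n) (hgm n)
  have hg'_int : Integrable g' μ := hm.mono' hg' <| by
    filter_upwards [hlim, ae_all_iff.2 hgm] with t ht htm
    exact le_of_tendsto' ht.norm htm
  have hstrong : Tendsto (fun n => ∫ t, u n t • (g n t - g' t) ∂μ) atTop (𝓝 0) := by
    rw [← integral_zero α E (μ := μ)]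
    refine tendsto_integral_of_dominated_convergence (fun t => C * (m t + ‖g' t‖))
      (fun n => (h.aestronglyMeasurable n).smul ((hg n).sub hg'))
      ((hm.add hg'_int.norm).const_mul C) (fun n => ?_) ?_
    · filter_upwards [h.ae_norm_le n, hgm n] with t hut hgt
      rw [norm_smul]
      exact mul_le_mul hut ((norm_sub_le _ _).trans (by gcongr)) (norm_nonneg _)
        ((norm_nonneg _).trans hut)
    · filter_upwards [hlim, ae_all_iff.2 h.ae_norm_le] with t ht hut
      refine squeeze_zero_norm (fun n => (norm_smul_le _ _).trans
        (mul_le_mul_of_nonneg_right (hut n) (norm_nonneg _))) ?_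
      simpa using ((ht.sub_const (g' t)).norm).const_mul C
  have hsplit (n : ℕ) : ∫ t, u n t • (g n t - g' t) ∂μ + ∫ t, u n t • g' t ∂μ =
      ∫ t, u n t • g n t ∂μ := by
    simpa only [sub_add_cancel] using (integral_smul_add (f := fun t => g n t - g' t)
      (h.aestronglyMeasurable n) (h.ae_norm_le n) ((hg_int n).sub hg'_int) hg'_int).symm
  simpa only [hsplit, zero_add] using hstrong.add (h.tendsto_integral_smul hg'_int)

theorem integral_sq_le [IsFiniteMeasure μ] (h : TendstoWeakStar μ u v C) {c : ℕ → ℝ} {c' : ℝ}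
    (hc : ∀ n, ∫ t, u n t ^ 2 ∂μ ≤ c n) (hc' : Tendsto c atTop (𝓝 c')) :
    ∫ t, v t ^ 2 ∂μ ≤ c' := by
  have h_int {w w' : α → ℝ} (hw : AEStronglyMeasurable w μ) (hwC : ∀ᵐ t ∂μ, ‖w t‖ ≤ C)
      (hw' : AEStronglyMeasurable w' μ) (hwC' : ∀ᵐ t ∂μ, ‖w' t‖ ≤ C) :
      Integrable (fun t => w t * w' t) μ := (Integrable.of_bound hw' C hwC').bdd_mul hw hwC
  have hv := h.aestronglyMeasurable_limit
  have hvC := h.ae_norm_limit_le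
  have hlower (n : ℕ) : 2 * ∫ t, u n t * v t ∂μ ≤ c n + ∫ t, v t ^ 2 ∂μ := by
    have hu := h.aestronglyMeasurable n
    have huC := h.ae_norm_le n
    have hu_sq := h_int hu huC hu huC
    have hv_sq := h_int hv hvC hv hvC
    simp_rw [← pow_two] at hu_sq hv_sq
    refine le_trans ?_ (add_le_add_left (hc n) _)
    rw [← integral_const_mul, ← integral_add hu_sq hv_sq]
    exact integral_mono ((h_int hu huC hv hvC).const_mul 2) (hu_sq.add hv_sq) fun t => by
      simpa only [mul_assoc] using two_mul_le_add_sq (u n t) (v t)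
  have hlim := (h.tendsto_integral_smul (Integrable.of_bound hv C hvC)).const_mul 2
  have := le_of_tendsto_of_tendsto' hlim (hc'.add_const _) hlower
  simp only [smul_eq_mul, ← pow_two] at this
  linarith

end TendstoWeakStar

end WeakStar

noncomputable section SkewControlSystem

open Filter Topology
open scoped RealInnerProductSpace

/-- The control system `x' = drift x + u(t) control(t) x` whose control part is skew-adjoint. The
control then does no work on `‖x‖ ^ 2`, so trajectories obey a bound that is uniform in `u`. -/
structure SkewControlSystem (E : Type*) [NormedAddCommGroup E] [InnerProductSpace ℝ E] where
  drift : E →L[ℝ] E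
  control : ℝ → E →L[ℝ] E
  inner_control_self : ∀ t x, ⟪x, control t x⟫ = 0

namespace SkewControlSystem

variable {E : Type*} [NormedAddCommGroup E] [InnerProductSpace ℝ E] (sys : SkewControlSystem E)

/-- The right-hand side of the differential equation at time `t` under the control value `v`. -/
def velocity (t v : ℝ) (x : E) : E := sys.drift x + v • sys.control t x

/-- A bound for the speed at points of norm at most `R` under control values of modulus at most
`M`. -/
def majorant (M R t : ℝ) : ℝ := ‖sys.drift‖ * R + M * (‖sys.control t‖ * R)

/-- A bound on `[a, b]` for the norm of every trajectory issuing from `x₀` at time `a`, whatever the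
control. -/
def stateBound (x₀ : E) (a b : ℝ) : ℝ := ‖x₀‖ * Real.exp (‖sys.drift‖ * (b - a))

/-- Carathéodory solutions on `[a, b]` for the control `u`, with initial value `x₀`. -/
structure IsTrajectory (u : ℝ → ℝ) (x₀ : E) (a b : ℝ) (x : ℝ → E) : Prop where
  initial : x a = x₀
  hasACDeriv : HasACDeriv x (fun t => sys.velocity t (u t) (x t)) a b

variable {sys} {a b M R : ℝ} {u : ℝ → ℝ} {x₀ : E} {x y : ℝ → E} {μ : Measure ℝ}

theorem norm_velocity_le {t v : ℝ} {z : E} (hv : ‖v‖ ≤ M) (hz : ‖z‖ ≤ R) :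
    ‖sys.velocity t v z‖ ≤ sys.majorant M R t := by
  refine (norm_add_le _ _).trans (add_le_add (sys.drift.le_of_opNorm_le_of_le le_rfl hz) ?_)
  rw [norm_smul]
  exact mul_le_mul hv ((sys.control t).le_of_opNorm_le_of_le le_rfl hz) (norm_nonneg _)
    ((norm_nonneg _).trans hv)

theorem inner_velocity_self_le (t v : ℝ) (z : E) :
    ⟪z, sys.velocity t v z⟫ ≤ ‖sys.drift‖ * ‖z‖ ^ 2 := by
  rw [velocity, inner_add_right, real_inner_smul_right, sys.inner_control_self, mul_zero, add_zero]
  calc ⟪z, sys.drift z⟫ ≤ ‖z‖ * ‖sys.drift z‖ := real_inner_le_norm _ _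
    _ ≤ ‖z‖ * (‖sys.drift‖ * ‖z‖) := by gcongr; exact sys.drift.le_opNorm z
    _ = ‖sys.drift‖ * ‖z‖ ^ 2 := by ring

theorem integrable_majorant [IsFiniteMeasure μ] (hB : Integrable sys.control μ) (M R : ℝ) :
    Integrable (sys.majorant M R) μ :=
  (integrable_const _).add ((hB.norm.mul_const R).const_mul M)

theorem aestronglyMeasurable_control_apply (hB : AEStronglyMeasurable sys.control μ)
    (hx : AEStronglyMeasurable x μ) : AEStronglyMeasurable (fun t => sys.control t (x t)) μ :=
  isBoundedBilinearMap_apply.continuous.comp_aestronglyMeasurable (hB.prodMk hx)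

theorem aestronglyMeasurable_velocity (hB : AEStronglyMeasurable sys.control μ)
    (hu : AEStronglyMeasurable u μ) (hx : AEStronglyMeasurable x μ) :
    AEStronglyMeasurable (fun t => sys.velocity t (u t) (x t)) μ :=
  (sys.drift.continuous.comp_aestronglyMeasurable hx).add
    (hu.smul (aestronglyMeasurable_control_apply hB hx))

theorem integrable_velocity [IsFiniteMeasure μ] (hB : Integrable sys.control μ)
    (hu : AEStronglyMeasurable u μ) (huM : ∀ᵐ t ∂μ, ‖u t‖ ≤ M) (hx : AEStronglyMeasurable x μ)
    (hxR : ∀ᵐ t ∂μ, ‖x t‖ ≤ R) : Integrable (fun t => sys.velocity t (u t) (x t)) μ := by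
  refine (integrable_majorant hB M R).mono' (aestronglyMeasurable_velocity hB.1 hu hx) ?_
  filter_upwards [huM, hxR] with t hut hxt using norm_velocity_le hut hxt

theorem tendsto_integral_velocity [CompleteSpace E] [IsFiniteMeasure μ]
    (hB : Integrable sys.control μ) {u : ℕ → ℝ → ℝ} {v : ℝ → ℝ} (huv : TendstoWeakStar μ u v M)
    {x : ℕ → ℝ → E} (hx : ∀ n, AEStronglyMeasurable (x n) μ) (hy : AEStronglyMeasurable y μ)
    (hxR : ∀ n, ∀ᵐ t ∂μ, ‖x n t‖ ≤ R)
    (hxy : ∀ᵐ t ∂μ, Tendsto (fun n => x n t) atTop (𝓝 (y t))) :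
    Tendsto (fun n => ∫ t, sys.velocity t (u n t) (x n t) ∂μ) atTop
      (𝓝 (∫ t, sys.velocity t (v t) (y t) ∂μ)) := by
  have hyR : ∀ᵐ t ∂μ, ‖y t‖ ≤ R := by
    filter_upwards [hxy, ae_all_iff.2 hxR] with t ht htR using le_of_tendsto' ht.norm htR
  have hsplit {w : ℝ → ℝ} {z : ℝ → E} (hw : AEStronglyMeasurable w μ) (hwM : ∀ᵐ t ∂μ, ‖w t‖ ≤ M)
      (hz : AEStronglyMeasurable z μ) (hzR : ∀ᵐ t ∂μ, ‖z t‖ ≤ R) :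
      ∫ t, sys.velocity t (w t) (z t) ∂μ =
        (∫ t, sys.drift (z t) ∂μ) + ∫ t, w t • sys.control t (z t) ∂μ := by
    refine integral_add (sys.drift.integrable_comp (Integrable.of_bound hz R hzR)) ?_
    refine Integrable.bdd_smul ?_ M hw hwM
    exact (hB.norm.mul_const R).mono' (aestronglyMeasurable_control_apply hB.1 hz)
      (hzR.mono fun t ht => (sys.control t).le_of_opNorm_le_of_le le_rfl ht)
  rw [hsplit huv.aestronglyMeasurable_limit huv.ae_norm_limit_le hy hyR]
  simp_rw [hsplit (huv.aestronglyMeasurable _) (huv.ae_norm_le _) (hx _) (hxR _)]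
  refine Tendsto.add ?_ (huv.tendsto_integral_smul_of_dominated
    (fun n => aestronglyMeasurable_control_apply hB.1 (hx n))
    (aestronglyMeasurable_control_apply hB.1 hy) (hB.norm.mul_const R)
    (fun n => (hxR n).mono fun t ht => (sys.control t).le_of_opNorm_le_of_le le_rfl ht)
    (hxy.mono fun t ht => ((sys.control t).continuous.tendsto _).comp ht))
  exact tendsto_integral_of_dominated_convergence (fun _ => ‖sys.drift‖ * R)
    (fun n => sys.drift.continuous.comp_aestronglyMeasurable (hx n)) (integrable_const _)
    (fun n => (hxR n).mono fun t ht => sys.drift.le_of_opNorm_le_of_le le_rfl ht)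
    (hxy.mono fun t ht => (sys.drift.continuous.tendsto _).comp ht)

namespace IsTrajectory

theorem sub (hx : sys.IsTrajectory u x₀ a b x) {y₀ : E} (hy : sys.IsTrajectory u y₀ a b y) :
    sys.IsTrajectory u (x₀ - y₀) a b fun t => x t - y t where
  initial := by rw [hx.initial, hy.initial]
  hasACDeriv := (hx.hasACDeriv.sub hy.hasACDeriv).congr_deriv <| ae_of_all _ fun t => by
    simp only [velocity, map_sub, smul_sub]
    abel

theorem clm_comp (hx : sys.IsTrajectory u x₀ a b x) (J : E →L[ℝ] E)
    (hdrift : ∀ z, J (sys.drift z) = sys.drift (J z))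
    (hcontrol : ∀ t z, J (sys.control t z) = sys.control t (J z)) :
    sys.IsTrajectory u (J x₀) a b fun t => J (x t) where
  initial := congrArg J hx.initial
  hasACDeriv := (hx.hasACDeriv.clm_comp J).congr_deriv <| ae_of_all _ fun t => by
    simp only [velocity, map_add, map_smul, hdrift, hcontrol]

theorem norm_le (hx : sys.IsTrajectory u x₀ a b x) {t : ℝ} (ht : t ∈ Icc a b) :
    ‖x t‖ ≤ ‖x₀‖ * Real.exp (‖sys.drift‖ * (t - a)) :=
  hx.initial ▸ hx.hasACDeriv.norm_le_mul_exp (ae_of_all _ fun s => inner_velocity_self_le s _ _) ht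

theorem norm_le_stateBound (hx : sys.IsTrajectory u x₀ a b x) {t : ℝ} (ht : t ∈ Icc a b) :
    ‖x t‖ ≤ sys.stateBound x₀ a b :=
  (hx.norm_le ht).trans <| by
    rw [stateBound]
    gcongr
    exact ht.2

theorem eqOn (hx : sys.IsTrajectory u x₀ a b x) (hy : sys.IsTrajectory u x₀ a b y) :
    EqOn x y (Icc a b) := fun t ht => by
  simpa [sub_eq_zero] using (hx.sub hy).norm_le ht

theorem apply_eq_self (hx : sys.IsTrajectory u x₀ a b x) {J : E →L[ℝ] E}
    (hdrift : ∀ z, J (sys.drift z) = sys.drift (J z))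
    (hcontrol : ∀ t z, J (sys.control t z) = sys.control t (J z)) (hJ : J x₀ = x₀) {t : ℝ}
    (ht : t ∈ Icc a b) : J (x t) = x t := by
  have hJx := hx.clm_comp J hdrift hcontrol
  rw [hJ] at hJx
  exact hJx.eqOn hx ht

theorem integrableOn_velocity (hx : sys.IsTrajectory u x₀ a b x)
    (hB : IntegrableOn sys.control (Icc a b))
    (hu : AEStronglyMeasurable u (volume.restrict (Icc a b)))
    (huM : ∀ᵐ t ∂volume.restrict (Icc a b), ‖u t‖ ≤ M) :
    IntegrableOn (fun t => sys.velocity t (u t) (x t)) (Icc a b) :=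
  integrable_velocity hB hu huM
    (hx.hasACDeriv.continuousOn.aestronglyMeasurable measurableSet_Icc)
    (ae_restrict_of_forall_mem measurableSet_Icc fun _ ht => hx.norm_le_stateBound ht)

theorem eq_integral [CompleteSpace E] (hx : sys.IsTrajectory u x₀ a b x)
    (hB : IntegrableOn sys.control (Icc a b))
    (hu : AEStronglyMeasurable u (volume.restrict (Icc a b)))
    (huM : ∀ᵐ t ∂volume.restrict (Icc a b), ‖u t‖ ≤ M) {t : ℝ} (ht : t ∈ Icc a b) :
    x t = x₀ + ∫ s in a..t, sys.velocity s (u s) (x s) := by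
  rw [(hx.hasACDeriv.mono ht).integral_eq_sub ht.1
    ((hx.integrableOn_velocity hB hu huM).mono_set (Icc_subset_Icc_right ht.2)), hx.initial,
    add_sub_cancel]

theorem dist_le [CompleteSpace E] (hx : sys.IsTrajectory u x₀ a b x)
    (hB : IntegrableOn sys.control (Icc a b))
    (hu : AEStronglyMeasurable u (volume.restrict (Icc a b)))
    (huM : ∀ᵐ t ∂volume.restrict (Icc a b), ‖u t‖ ≤ M) {s t : ℝ} (hs : s ∈ Icc a b)
    (ht : t ∈ Icc a b) :
    dist (x s) (x t) ≤
      dist (∫ r in a..s, sys.majorant M (sys.stateBound x₀ a b) r)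
        (∫ r in a..t, sys.majorant M (sys.stateBound x₀ a b) r) := by
  have hsub {c d : ℝ} (hc : c ∈ Icc a b) (hd : d ∈ Icc a b) : uIcc c d ⊆ Icc a b :=
    ordConnected_Icc.uIcc_subset hc hd
  have ha : a ∈ Icc a b := ⟨le_rfl, hs.1.trans hs.2⟩
  have hvel {c d : ℝ} (hc : c ∈ Icc a b) (hd : d ∈ Icc a b) :=
    ((hx.integrableOn_velocity hB hu huM).mono_set (hsub hc hd)).intervalIntegrable
  have hmaj {c d : ℝ} (hc : c ∈ Icc a b) (hd : d ∈ Icc a b) :=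
    (IntegrableOn.mono_set (integrable_majorant hB M (sys.stateBound x₀ a b))
      (hsub hc hd)).intervalIntegrable
  rw [hx.eq_integral hB hu huM hs, hx.eq_integral hB hu huM ht, dist_add_left, dist_eq_norm,
    Real.dist_eq, intervalIntegral.integral_interval_sub_left (hvel ha hs) (hvel ha ht),
    intervalIntegral.integral_interval_sub_left (hmaj ha hs) (hmaj ha ht)]
  refine intervalIntegral.norm_integral_le_abs_of_norm_le ?_ (hmaj ht hs)
  rw [ae_restrict_iff' measurableSet_uIoc]
  filter_upwards [(ae_restrict_iff' measurableSet_Icc).1 huM] with r hur hr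
  have hr_mem := hsub ht hs (uIoc_subset_uIcc hr)
  exact norm_velocity_le (hur hr_mem) (hx.norm_le_stateBound hr_mem)

end IsTrajectory

theorem exists_subseq_tendsto_trajectory [ProperSpace E] (hab : a ≤ b)
    (hB : IntegrableOn sys.control (Icc a b)) {u : ℕ → ℝ → ℝ} {v : ℝ → ℝ}
    (huv : TendstoWeakStar (volume.restrict (Icc a b)) u v M) {x : ℕ → ℝ → E}
    (hx : ∀ n, sys.IsTrajectory (u n) x₀ a b (x n)) :
    ∃ (y : ℝ → E) (φ : ℕ → ℕ), StrictMono φ ∧ sys.IsTrajectory v x₀ a b y ∧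
      ∀ t ∈ Icc a b, Tendsto (fun n => x (φ n) t) atTop (𝓝 (y t)) := by
  have hprim : ContinuousOn
      (fun t => ∫ r in a..t, sys.majorant M (sys.stateBound x₀ a b) r)
      (Icc a b) := by
    rw [← uIcc_of_le hab]
    refine intervalIntegral.continuousOn_primitive_interval ?_
    rw [uIcc_of_le hab]
    exact integrable_majorant hB M _
  obtain ⟨y, φ, hy, hφ, hlim⟩ := exists_subseq_tendsto_of_dist_le_dist_Icc hab hprim
    (fun n => (hx n).initial) fun n s hs t ht =>
      (hx n).dist_le hB (huv.aestronglyMeasurable n) (huv.ae_norm_le n) hs ht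
  have hya : y a = x₀ := tendsto_nhds_unique (hlim a (left_mem_Icc.2 hab))
    (tendsto_const_nhds.congr fun n => (hx (φ n)).initial.symm)
  refine ⟨y, φ, hφ, ⟨hya, ?_⟩, hlim⟩
  refine HasACDeriv.of_integral_eq (c := x₀) hab ?_ fun t ht => ?_
  · refine integrable_velocity hB huv.aestronglyMeasurable_limit huv.ae_norm_limit_le
      hy.aestronglyMeasurable (ae_restrict_of_forall_mem measurableSet_Icc fun t ht =>
        le_of_tendsto' (hlim t ht).norm fun n => (hx (φ n)).norm_le_stateBound ht)
  have hsub : Ioc a t ⊆ Icc a b := fun s hs => ⟨hs.1.le, hs.2.trans ht.2⟩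
  have huv_t := (huv.subseq hφ).restrict (measurableSet_Ioc (a := a) (b := t))
  rw [Measure.restrict_restrict_of_subset hsub] at huv_t
  have h_int := tendsto_integral_velocity (IntegrableOn.mono_set hB hsub) huv_t
    (fun n => ((hx (φ n)).hasACDeriv.continuousOn.mono hsub).aestronglyMeasurable measurableSet_Ioc)
    hy.aestronglyMeasurable
    (fun n => ae_restrict_of_forall_mem measurableSet_Ioc fun s hs =>
      (hx (φ n)).norm_le_stateBound (hsub hs))
    (ae_restrict_of_forall_mem measurableSet_Ioc fun s hs => hlim s (hsub hs))
  simp_rw [← intervalIntegral.integral_of_le ht.1] at h_int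
  exact tendsto_nhds_unique (hlim t ht) <| (h_int.const_add x₀).congr fun n =>
    ((hx (φ n)).eq_integral hB (huv.aestronglyMeasurable _) (huv.ae_norm_le _) ht).symm

variable (sys) in
/-- The measurable controls with values in `[c, d]` under which the state issuing from `x₀` stays in
`F`. -/
def viableControls (x₀ : E) (a b c d : ℝ) (F : Set E) : Set (ℝ → ℝ) :=
  {u | AEStronglyMeasurable u (volume.restrict (Icc a b)) ∧
    (∀ᵐ t ∂volume.restrict (Icc a b), u t ∈ Icc c d) ∧
    ∃ x, sys.IsTrajectory u x₀ a b x ∧ ∀ t ∈ Icc a b, x t ∈ F}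

theorem exists_isMinOn_integral_sq [ProperSpace E] (hab : a ≤ b)
    (hB : IntegrableOn sys.control (Icc a b)) {c d : ℝ} {F : Set E} (hF : IsClosed F)
    (hne : (sys.viableControls x₀ a b c d F).Nonempty) :
    ∃ v ∈ sys.viableControls x₀ a b c d F,
      IsMinOn (fun u => ∫ t in Icc a b, u t ^ 2) (sys.viableControls x₀ a b c d F) v := by
  let J : (ℝ → ℝ) → ℝ := fun u => ∫ t in Icc a b, u t ^ 2
  have hJ_bdd : BddBelow (J '' sys.viableControls x₀ a b c d F) :=
    ⟨0, by rintro _ ⟨u, -, rfl⟩; exact integral_nonneg fun t => sq_nonneg (u t)⟩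
  obtain ⟨j, -, hj, hj_mem⟩ := exists_seq_tendsto_sInf (hne.image J) hJ_bdd
  choose u hu huj using hj_mem
  choose x hx hxF using fun n => (hu n).2.2
  obtain ⟨v, φ, hφ, hvcd, huv⟩ := exists_subseq_tendstoWeakStar
    (fun n => (hu n).1) fun n => (hu n).2.1
  obtain ⟨y, ψ, -, hy, hxy⟩ := exists_subseq_tendsto_trajectory hab hB huv fun n => hx (φ n)
  refine ⟨v, ⟨huv.aestronglyMeasurable_limit, hvcd, y, hy, fun t ht =>
    hF.mem_of_tendsto (hxy t ht) (Eventually.of_forall fun n => hxF _ t ht)⟩, fun w hw => ?_⟩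
  exact (huv.integral_sq_le (fun n => (huj (φ n)).le) (hj.comp hφ.tendsto_atTop)).trans
    (csInf_le hJ_bdd (mem_image_of_mem J hw))

end SkewControlSystem

/-- The retraction of the space onto the closed ball of radius `R` along rays. -/
def radialRetraction {E : Type*} [NormedAddCommGroup E] [NormedSpace ℝ E] (R : ℝ) (x : E) : E :=
  (R / max R ‖x‖) • x

section radialRetraction

variable {E : Type*} [NormedAddCommGroup E] [NormedSpace ℝ E] {R : ℝ}

theorem continuous_radialRetraction (hR : 0 < R) :
    Continuous (radialRetraction R : E → E) :=
  (continuous_const.div (continuous_const.max continuous_norm)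
    fun _ => (hR.trans_le (le_max_left _ _)).ne').smul continuous_id

theorem norm_radialRetraction_le (hR : 0 < R) (x : E) : ‖radialRetraction R x‖ ≤ R := by
  have hmax : 0 < max R ‖x‖ := hR.trans_le (le_max_left _ _)
  rw [radialRetraction, norm_smul, Real.norm_of_nonneg (by positivity), div_mul_eq_mul_div,
    div_le_iff₀ hmax]
  gcongr
  exact le_max_right _ _

theorem radialRetraction_eq_self (hR : 0 < R) {x : E} (hx : ‖x‖ ≤ R) :
    radialRetraction R x = x := by
  rw [radialRetraction, max_eq_left hx, div_self hR.ne', one_smul]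

end radialRetraction

namespace SkewControlSystem

variable {E : Type*} [NormedAddCommGroup E] [InnerProductSpace ℝ E] {sys : SkewControlSystem E}
  {a b D R : ℝ} {x₀ : E} {x : ℝ → E} {w : ℝ → E → ℝ}

theorem inner_velocity_radialRetraction_le (hR : 0 < R) (t v : ℝ) (z : E) :
    ⟪z, sys.velocity t v (radialRetraction R z)⟫ ≤ ‖sys.drift‖ * ‖z‖ ^ 2 := by
  have hlinear : sys.velocity t v (radialRetraction R z) =
      (R / max R ‖z‖) • sys.velocity t v z := by
    simp only [velocity, radialRetraction, map_smul, smul_add, smul_comm v]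
  have hmax : 0 < max R ‖z‖ := hR.trans_le (le_max_left _ _)
  rw [hlinear, real_inner_smul_right]
  exact (mul_le_mul_of_nonneg_left (inner_velocity_self_le t v z) (by positivity)).trans
    (mul_le_of_le_one_left (by positivity) ((div_le_one hmax).2 (le_max_left _ _)))

theorem isCaratheodory_velocity_radialRetraction (hB : IntegrableOn sys.control (Icc a b))
    (hw_cont : ∀ t, Continuous (w t))
    (hw_meas : ∀ x : ℝ → E, Continuous x →
      AEStronglyMeasurable (fun t => w t (x t)) (volume.restrict (Icc a b)))
    (hR : 0 < R) (hwD : ∀ t z, ‖z‖ ≤ R → ‖w t z‖ ≤ D) :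
    IsCaratheodory (volume.restrict (Icc a b))
      (fun t z => sys.velocity t (w t (radialRetraction R z)) (radialRetraction R z))
      (sys.majorant D R) where
  ae_continuous := ae_of_all _ fun t => by
    have hr := continuous_radialRetraction (E := E) hR
    exact (sys.drift.continuous.comp hr).add
      (((hw_cont t).comp hr).smul ((sys.control t).continuous.comp hr))
  aestronglyMeasurable x hx := by
    have hrx := (continuous_radialRetraction (E := E) hR).comp hx
    exact aestronglyMeasurable_velocity hB.1 (hw_meas _ hrx) hrx.aestronglyMeasurable
  integrable_majorant := integrable_majorant hB D R
  ae_norm_le := ae_of_all _ fun t z =>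
    norm_velocity_le (hwD t _ (norm_radialRetraction_le hR z)) (norm_radialRetraction_le hR z)

/- The equation is truncated outside the ball of radius `R`; the a priori bound shows that the
solution of the truncated equation never leaves this ball. -/
theorem exists_closedLoop_trajectory [ProperSpace E] (hab : a ≤ b)
    (hB : IntegrableOn sys.control (Icc a b)) (hw_cont : ∀ t, Continuous (w t))
    (hw_meas : ∀ x : ℝ → E, Continuous x →
      AEStronglyMeasurable (fun t => w t (x t)) (volume.restrict (Icc a b)))
    (hR : 0 < R) (hx₀ : sys.stateBound x₀ a b ≤ R) (hwD : ∀ t z, ‖z‖ ≤ R → ‖w t z‖ ≤ D) :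
    ∃ x, Continuous x ∧ sys.IsTrajectory (fun t => w t (x t)) x₀ a b x := by
  have hf := isCaratheodory_velocity_radialRetraction hB hw_cont hw_meas hR hwD
  obtain ⟨x, hx, hx_eq⟩ := hf.exists_integral_eq hab x₀
  have hxa : x a = x₀ := by simpa using hx_eq a (left_mem_Icc.2 hab)
  have hderiv := HasACDeriv.of_integral_eq (x := x) (c := x₀) hab (hf.integrable_comp hx)
    fun t ht => by
    rw [hx_eq t ht, intervalIntegral.integral_of_le ht.1, intervalIntegral.integral_of_le ht.1,
      Measure.restrict_restrict_of_subset
        (Ioc_subset_Icc_self.trans (Icc_subset_Icc_right ht.2))]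
  have hxR : ∀ t ∈ Icc a b, ‖x t‖ ≤ R := fun t ht => by
    refine (hderiv.norm_le_mul_exp
      (ae_of_all _ fun s => inner_velocity_radialRetraction_le hR s _ _) ht).trans
      (le_trans ?_ hx₀)
    rw [stateBound, hxa]
    gcongr
    exact ht.2
  refine ⟨x, hx, hxa, hderiv.congr_deriv ?_⟩
  filter_upwards [ae_restrict_mem measurableSet_Icc] with t ht
  rw [radialRetraction_eq_self hR (hxR t ht)]

variable {V : E → ℝ} {e : ℝ}

variable (sys) in
/-- The feedback that keeps the output `V` constant: it solves `d/dt V(x(t)) = 0` for the control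
value. The denominator is cut off at `e ^ 2`, which makes the feedback continuous and bounded. -/
def outputFeedback (V : E → ℝ) (e t : ℝ) (z : E) : ℝ :=
  -(fderiv ℝ V z (sys.drift z) * fderiv ℝ V z (sys.control t z)) /
    max (fderiv ℝ V z (sys.control t z) ^ 2) (e ^ 2)

theorem continuous_outputFeedback (hV : ContDiff ℝ 1 V) (he : 0 < e) (t : ℝ) :
    Continuous (sys.outputFeedback V e t) := by
  have hdV := hV.continuous_fderiv one_ne_zero
  have hgain : Continuous fun z => fderiv ℝ V z (sys.control t z) :=
    hdV.clm_apply (sys.control t).continuous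
  exact ((hdV.clm_apply sys.drift.continuous).mul hgain).neg.div
    ((hgain.pow 2).max continuous_const) fun z => ((pow_pos he 2).trans_le (le_max_right _ _)).ne'

theorem aestronglyMeasurable_outputFeedback {μ : Measure ℝ} (hV : ContDiff ℝ 1 V)
    (hB : AEStronglyMeasurable sys.control μ) (hx : Continuous x) :
    AEStronglyMeasurable (fun t => sys.outputFeedback V e t (x t)) μ := by
  have hdV : Continuous fun t => fderiv ℝ V (x t) := (hV.continuous_fderiv one_ne_zero).comp hx
  have hgain : AEStronglyMeasurable (fun t => fderiv ℝ V (x t) (sys.control t (x t))) μ :=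
    isBoundedBilinearMap_apply.continuous.comp_aestronglyMeasurable <|
      hdV.aestronglyMeasurable.prodMk
        (aestronglyMeasurable_control_apply hB hx.aestronglyMeasurable)
  have hdrift := (hdV.clm_apply (sys.drift.continuous.comp hx)).aestronglyMeasurable (μ := μ)
  exact ((hdrift.mul hgain).neg.aemeasurable.div
    ((hgain.pow 2).aemeasurable.max aemeasurable_const)).aestronglyMeasurable

theorem norm_outputFeedback_le (he : 0 < e) (t : ℝ) (z : E) :
    ‖sys.outputFeedback V e t z‖ ≤ ‖fderiv ℝ V z (sys.drift z)‖ / e := by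
  set g := fderiv ℝ V z (sys.control t z) with hg
  have hmax : 0 < max (g ^ 2) (e ^ 2) := (pow_pos he 2).trans_le (le_max_right _ _)
  have hge : ‖g‖ * e ≤ max (g ^ 2) (e ^ 2) := by
    rw [← sq_abs g, ← Real.norm_eq_abs]
    nlinarith [sq_nonneg (‖g‖ - e), le_max_left (‖g‖ ^ 2) (e ^ 2), le_max_right (‖g‖ ^ 2) (e ^ 2)]
  rw [outputFeedback, ← hg, norm_div, norm_neg, norm_mul, Real.norm_of_nonneg hmax.le,
    div_le_div_iff₀ hmax he, mul_assoc]
  gcongr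

theorem fderiv_velocity_outputFeedback (he : 0 < e) {t : ℝ} {z : E}
    (hgain : e ≤ ‖fderiv ℝ V z (sys.control t z)‖) :
    fderiv ℝ V z (sys.velocity t (sys.outputFeedback V e t z) z) = 0 := by
  have hsq : e ^ 2 ≤ fderiv ℝ V z (sys.control t z) ^ 2 := by
    rw [← sq_abs (fderiv ℝ V z (sys.control t z)), ← Real.norm_eq_abs]
    gcongr
  have hne : fderiv ℝ V z (sys.control t z) ≠ 0 := norm_pos_iff.1 (he.trans_le hgain)
  rw [velocity, map_add, map_smul, outputFeedback, max_eq_left hsq, smul_eq_mul]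
  field_simp
  ring

theorem exists_outputFeedback_trajectory [ProperSpace E] (hab : a ≤ b)
    (hB : IntegrableOn sys.control (Icc a b)) (hV : ContDiff ℝ 1 V) (he : 0 < e) (x₀ : E) :
    ∃ (M : ℝ) (x : ℝ → E), Continuous x ∧
      sys.IsTrajectory (fun t => sys.outputFeedback V e t (x t)) x₀ a b x ∧
      ∀ t ∈ Icc a b, ‖sys.outputFeedback V e t (x t)‖ ≤ M := by
  set R := max (sys.stateBound x₀ a b) 1
  obtain ⟨D, hD⟩ := (isCompact_closedBall (0 : E) R).exists_bound_of_continuousOn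
    ((hV.continuous_fderiv one_ne_zero).clm_apply sys.drift.continuous).continuousOn
  have hbound (t : ℝ) (z : E) (hz : ‖z‖ ≤ R) : ‖sys.outputFeedback V e t z‖ ≤ D / e :=
    (norm_outputFeedback_le he t z).trans <| by
      gcongr
      exact hD z (mem_closedBall_zero_iff.2 hz)
  obtain ⟨x, hx, hx_traj⟩ := exists_closedLoop_trajectory hab hB
    (continuous_outputFeedback hV he)
    (fun x hx => aestronglyMeasurable_outputFeedback hV hB.1 hx)
    (one_pos.trans_le (le_max_right _ _)) (le_max_left _ _) hbound
  exact ⟨D / e, x, hx, hx_traj, fun t ht =>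
    hbound t _ ((hx_traj.norm_le_stateBound ht).trans (le_max_left _ _))⟩

theorem eventually_lt_norm_gain {t : ℝ} (hV : ContDiff ℝ 1 V)
    (hB : ContinuousWithinAt sys.control (Ici t) t) (hx : Continuous x)
    (hgain : e < ‖fderiv ℝ V (x t) (sys.control t (x t))‖) :
    ∀ᶠ s in 𝓝[≥] t, e < ‖fderiv ℝ V (x s) (sys.control s (x s))‖ := by
  have hdV := ((hV.continuous_fderiv one_ne_zero).comp hx).continuousWithinAt (s := Ici t) (x := t)
  exact (hdV.clm_apply (hB.clm_apply hx.continuousWithinAt)).norm.eventually_const_lt hgain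

theorem apply_eq_of_forall_gain (hV : ContDiff ℝ 1 V) (he : 0 < e)
    (hx : sys.IsTrajectory (fun t => sys.outputFeedback V e t (x t)) x₀ a b x) {t : ℝ}
    (ht : t ∈ Icc a b)
    (hgain : ∀ s ∈ Icc a t, e ≤ ‖fderiv ℝ V (x s) (sys.control s (x s))‖) : V (x t) = V x₀ := by
  have hVx := (hx.hasACDeriv.mono ht).contDiff_comp hV
  have hconst : ∫ _ in a..t, (0 : ℝ) = V (x t) - V (x a) :=
    (hVx.congr_deriv <| by
      filter_upwards [ae_restrict_mem measurableSet_Icc] with s hs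
        using fderiv_velocity_outputFeedback he (hgain s hs)).integral_eq_sub_real ht.1
  rw [intervalIntegral.integral_zero, hx.initial] at hconst
  exact (sub_eq_zero.1 hconst.symm)

/- The output stays constant for as long as the gain is at least `e`, and, by right-continuity, a
gain above `e` at time `t` persists beyond `t`. -/
theorem apply_eq_of_outputFeedback (hV : ContDiff ℝ 1 V) (he : 0 < e)
    (hB : ∀ t ∈ Ico a b, ContinuousWithinAt sys.control (Ici t) t) (hx_cont : Continuous x)
    (hx : sys.IsTrajectory (fun t => sys.outputFeedback V e t (x t)) x₀ a b x)
    (hgain : ∀ t ∈ Icc a b, (∀ s ∈ Icc a t, V (x s) = V x₀) →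
      e < ‖fderiv ℝ V (x t) (sys.control t (x t))‖) :
    ∀ t ∈ Icc a b, V (x t) = V x₀ := by
  have hclosed : IsClosed ({t | V (x t) = V x₀} ∩ Icc a b) :=
    (isClosed_eq (hV.continuous.comp hx_cont) continuous_const).inter isClosed_Icc
  refine hclosed.Icc_subset_of_forall_mem_nhdsGT_of_Icc_subset (by simp [hx.initial])
    fun t ht hVt => ?_
  have hgain_le (s : ℝ) (hs : s ∈ Icc a t) :
      e ≤ ‖fderiv ℝ V (x s) (sys.control s (x s))‖ :=
    (hgain s ⟨hs.1, hs.2.trans ht.2.le⟩ fun r hr => hVt ⟨hr.1, hr.2.trans hs.2⟩).le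
  obtain ⟨c, htc, hc⟩ := (mem_nhdsGE_iff_exists_Ico_subset' ht.2).1 <|
    eventually_lt_norm_gain hV (hB t ht) hx_cont
      (hgain t (Ico_subset_Icc_self ht) fun s hs => hVt hs)
  filter_upwards [Ioo_mem_nhdsGT (lt_min htc ht.2)] with s hs
  refine apply_eq_of_forall_gain hV he hx
    ⟨ht.1.trans hs.1.le, (hs.2.trans_le (min_le_right _ _)).le⟩ fun r hr => ?_
  rcases le_total r t with hrt | htr
  · exact hgain_le r ⟨hr.1, hrt⟩
  · exact (hc ⟨htr, hr.2.trans_lt (hs.2.trans_le (min_le_left _ _))⟩).le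

end SkewControlSystem

end SkewControlSystem

noncomputable section Lindblad

open Filter Topology
open scoped Matrix.Norms.Frobenius RealInnerProductSpace

/-- The uniform structure of the Frobenius norm, preferred here to the entrywise one, with which it
agrees only up to unfolding. -/
abbrev frobeniusUniformSpace {N : ℕ} : UniformSpace (CMat N) :=
  Matrix.frobeniusNormedAddCommGroup.toPseudoMetricSpace.toUniformSpace

/-- The topology of the Frobenius norm. -/
abbrev frobeniusTopologicalSpace {N : ℕ} : TopologicalSpace (CMat N) :=
  frobeniusUniformSpace.toTopologicalSpace

attribute [local instance] frobeniusUniformSpace frobeniusTopologicalSpace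

variable {N K : ℕ}

/-- The real inner product `Re Tr(A† B)`, which induces the Frobenius norm. -/
abbrev frobeniusInnerProductSpace : InnerProductSpace ℝ (CMat N) where
  inner A B := (Aᴴ * B).trace.re
  norm_sq_eq_re_inner A := by
    simp only [Matrix.frobenius_norm_def, Matrix.trace, Matrix.diag, Matrix.mul_apply,
      Matrix.conjTranspose_apply, RCLike.re_to_real]
    rw [← Real.sqrt_eq_rpow, Real.sq_sqrt (by positivity), Finset.sum_comm, Complex.re_sum]
    refine Finset.sum_congr rfl fun i _ => ?_
    rw [Complex.re_sum]
    refine Finset.sum_congr rfl fun j _ => ?_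
    rw [RCLike.star_def, ← Complex.normSq_eq_conj_mul_self, Complex.ofReal_re,
      Complex.normSq_eq_norm_sq, Real.rpow_two]
  conj_inner_symm A B := by
    rw [← Matrix.conjTranspose_conjTranspose A, ← Matrix.conjTranspose_mul,
      Matrix.trace_conjTranspose]
    simp
  add_left A B C := by simp [add_mul]
  smul_left A B r := by simp

attribute [local instance] frobeniusInnerProductSpace

theorem inner_eq_re_trace (A B : CMat N) : ⟪A, B⟫ = (Aᴴ * B).trace.re := rfl

theorem im_trace_mul_eq_zero {A B : CMat N} (hA : A.IsHermitian) (hB : B.IsHermitian) :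
    (A * B).trace.im = 0 := by
  rw [← Complex.conj_eq_iff_im, starRingEnd_apply, ← Matrix.trace_conjTranspose,
    Matrix.conjTranspose_mul, hA.eq, hB.eq, Matrix.trace_mul_comm]

/-- The field `ρ ↦ -(i/ℏ) [H, ρ]` generated by a Hamiltonian `H`, linear in both `H` and `ρ`. -/
def hamiltonianFlow (hbar : ℝ) : CMat N →L[ℝ] CMat N →L[ℝ] CMat N :=
  (-(Complex.I / (hbar : ℂ))) •
    (ContinuousLinearMap.mul ℝ (CMat N) - (ContinuousLinearMap.mul ℝ (CMat N)).flip)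

theorem hamiltonianFlow_apply (hbar : ℝ) (H ρ : CMat N) :
    hamiltonianFlow hbar H ρ = (-(Complex.I / (hbar : ℂ))) • ⁅H, ρ⁆ := rfl

theorem conjTranspose_hamiltonianFlow (hbar : ℝ) {H : CMat N} (hH : H.IsHermitian) (ρ : CMat N) :
    (hamiltonianFlow hbar H ρ)ᴴ = hamiltonianFlow hbar H ρᴴ := by
  simp only [hamiltonianFlow_apply, Ring.lie_def, Matrix.conjTranspose_smul,
    Matrix.conjTranspose_sub, Matrix.conjTranspose_mul, hH.eq]
  rw [← neg_sub (H * ρᴴ), smul_neg, ← neg_smul]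
  congr 1
  simp [neg_div]

theorem inner_hamiltonianFlow_self (hbar : ℝ) {H : CMat N} (hH : H.IsHermitian) (ρ : CMat N) :
    ⟪ρ, hamiltonianFlow hbar H ρ⟫ = 0 := by
  have hleft : (ρᴴ * (H * ρ)).trace.im = 0 := by
    rw [Matrix.trace_mul_comm, mul_assoc, im_trace_mul_eq_zero hH
      (Matrix.isHermitian_mul_conjTranspose_self ρ)]
  have hright : (ρᴴ * (ρ * H)).trace.im = 0 := by
    rw [← mul_assoc, im_trace_mul_eq_zero (Matrix.isHermitian_conjTranspose_mul_self ρ) hH]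
  have hre : (-(Complex.I / (hbar : ℂ))).re = 0 := by simp [Complex.div_re]
  rw [inner_eq_re_trace, hamiltonianFlow_apply, Ring.lie_def, Matrix.mul_smul, Matrix.trace_smul,
    mul_sub, Matrix.trace_sub, smul_eq_mul, Complex.mul_re, Complex.sub_im, hleft, hright, hre]
  simp

/-- The real expectation value `Re ⟨A⟩_ρ` as a linear functional of `ρ`. -/
def reExpVal (A : CMat N) : CMat N →L[ℝ] ℝ :=
  Complex.reCLM ∘L LinearMap.toContinuousLinearMap (Matrix.traceLinearMap (Fin N) ℝ ℂ) ∘L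
    (ContinuousLinearMap.mul ℝ (CMat N)).flip A

theorem isHermitian_deltaRe (j k : Fin N) : (deltaRe j k).IsHermitian := by
  simp [Matrix.IsHermitian, deltaRe, Matrix.conjTranspose_add, add_comm]

theorem isHermitian_deltaIm (j k : Fin N) : (deltaIm j k).IsHermitian := by
  simp [Matrix.IsHermitian, deltaIm, Matrix.conjTranspose_add, add_comm]

theorem ofReal_reExpVal {A ρ : CMat N} (hA : A.IsHermitian) (hρ : ρ.IsHermitian) :
    (reExpVal A ρ : ℂ) = expVal ρ A :=
  Complex.ext rfl (im_trace_mul_eq_zero hρ hA).symm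

theorem expVal_hamiltonianFlow (hbar : ℝ) (H ρ A : CMat N) :
    expVal (hamiltonianFlow hbar H ρ) A = -(Complex.I / hbar) * expVal ρ ⁅A, H⁆ := by
  simp only [expVal, hamiltonianFlow_apply, Ring.lie_def, Matrix.smul_mul, Matrix.trace_smul,
    sub_mul, mul_sub, Matrix.trace_sub, smul_eq_mul]
  rw [mul_assoc H ρ A, Matrix.trace_mul_comm H, mul_assoc, mul_assoc]

theorem coherence_sq (ρ : CMat N) : coherence ρ ^ 2 =
    ∑ p ∈ levelPairs N, (reExpVal (deltaRe p.1 p.2) ρ ^ 2 + reExpVal (deltaIm p.1 p.2) ρ ^ 2) :=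
  Real.sq_sqrt (Finset.sum_nonneg fun _ _ => by positivity)

theorem contDiff_coherence_sq : ContDiff ℝ 1 fun ρ : CMat N => coherence ρ ^ 2 := by
  simp only [coherence_sq]
  fun_prop

theorem fderiv_coherence_sq (ρ X : CMat N) :
    fderiv ℝ (fun ρ : CMat N => coherence ρ ^ 2) ρ X =
      ∑ p ∈ levelPairs N,
        2 * (reExpVal (deltaRe p.1 p.2) ρ * reExpVal (deltaRe p.1 p.2) X +
          reExpVal (deltaIm p.1 p.2) ρ * reExpVal (deltaIm p.1 p.2) X) := by
  simp only [coherence_sq]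
  have hderiv := HasFDerivAt.fun_sum (u := levelPairs N) (x := ρ) fun p _ =>
    ((reExpVal (deltaRe p.1 p.2)).hasFDerivAt.pow 2).fun_add
      ((reExpVal (deltaIm p.1 p.2)).hasFDerivAt.pow 2)
  rw [hderiv.fderiv, sum_apply]
  refine Finset.sum_congr rfl fun p _ => ?_
  simp
  ring

theorem Phi_eq_fderiv_coherence_sq {hbar : ℝ} (hbar_ne : hbar ≠ 0) {H ρ : CMat N}
    (hH : H.IsHermitian) (hρ : ρ.IsHermitian) :
    Phi H ρ = ↑(hbar * fderiv ℝ (fun ρ : CMat N => coherence ρ ^ 2) ρ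
      (hamiltonianFlow hbar H ρ)) := by
  have hflow : (hamiltonianFlow hbar H ρ).IsHermitian := by
    rw [Matrix.IsHermitian, conjTranspose_hamiltonianFlow hbar hH, hρ.eq]
  have hbar_ne' : (hbar : ℂ) ≠ 0 := by exact_mod_cast hbar_ne
  rw [fderiv_coherence_sq, Phi]
  push_cast
  rw [Finset.mul_sum, Finset.mul_sum]
  refine Finset.sum_congr rfl fun p _ => ?_
  have hRe := isHermitian_deltaRe p.1 p.2
  have hIm := isHermitian_deltaIm p.1 p.2
  rw [ofReal_reExpVal hRe hρ, ofReal_reExpVal hIm hρ, ofReal_reExpVal hRe hflow,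
    ofReal_reExpVal hIm hflow, expVal_hamiltonianFlow, expVal_hamiltonianFlow]
  field_simp
  ring

/-- The embedding of `ℂ` into the matrices as the `(i, j)` entry. -/
def singleCLM (i j : Fin N) : ℂ →L[ℝ] CMat N :=
  LinearMap.toContinuousLinearMap (Matrix.singleLinearMap ℝ i j)

theorem sum_singleCLM (A : CMat N) : ∑ i, ∑ j, singleCLM i j (A i j) = A :=
  (Matrix.matrix_eq_sum_single A).symm

theorem hasACDeriv_matrix_iff {ρ ρ' : ℝ → CMat N} {a b : ℝ} :
    HasACDeriv ρ ρ' a b ↔ ∀ i j, HasACDeriv (fun t => ρ t i j) (fun t => ρ' t i j) a b := by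
  refine ⟨fun h i j => h.clm_comp
    (LinearMap.toContinuousLinearMap (Matrix.entryLinearMap ℝ ℂ i j)), fun h => ?_⟩
  have hsum := HasACDeriv.sum Finset.univ fun i _ =>
    HasACDeriv.sum Finset.univ fun j _ => (h i j).clm_comp (singleCLM i j)
  simpa only [sum_singleCLM] using hsum

theorem integrable_of_integrable_entry {μ : Measure ℝ} {A : ℝ → CMat N}
    (hA : ∀ i j, Integrable (fun t => A t i j) μ) : Integrable A μ := by
  have hsum := integrable_finsetSum Finset.univ fun i _ =>
    integrable_finsetSum Finset.univ fun j _ => (singleCLM i j).integrable_comp (hA i j)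
  simpa only [sum_singleCLM] using hsum

namespace OpenSystem

/-- The Lindblad equation as a control system on the matrices with the Frobenius inner product. -/
def toSkewControlSystem (S : OpenSystem N K) : SkewControlSystem (CMat N) where
  drift := hamiltonianFlow S.hbar S.H₀ + ∑ k, (S.γ k : ℂ) •
    (ContinuousLinearMap.mulLeftRight ℝ (CMat N) (S.L k) (S.L k)ᴴ - (1 / 2 : ℂ) •
      (ContinuousLinearMap.mul ℝ (CMat N) ((S.L k)ᴴ * S.L k) +
        (ContinuousLinearMap.mul ℝ (CMat N)).flip ((S.L k)ᴴ * S.L k)))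
  control t := hamiltonianFlow S.hbar (S.Hc t)
  inner_control_self t := inner_hamiltonianFlow_self S.hbar (S.Hc_herm t)

variable {S : OpenSystem N K} {t₀ tf : ℝ} {ρ₀ : CMat N} {u : ℝ → ℝ} {ρ : ℝ → CMat N}

theorem toSkewControlSystem_drift_apply (ρ : CMat N) :
    S.toSkewControlSystem.drift ρ = hamiltonianFlow S.hbar S.H₀ ρ + S.dissipator ρ := by
  simp [toSkewControlSystem, dissipator]

theorem toSkewControlSystem_velocity (t v : ℝ) (ρ : CMat N) :
    S.toSkewControlSystem.velocity t v ρ = S.rhs t v ρ := by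
  have hflow : hamiltonianFlow S.hbar (S.H₀ + (v : ℂ) • S.Hc t) ρ =
      hamiltonianFlow S.hbar S.H₀ ρ + v • hamiltonianFlow S.hbar (S.Hc t) ρ := by
    rw [Complex.coe_smul, map_add, map_smul]
    rfl
  rw [SkewControlSystem.velocity, toSkewControlSystem_drift_apply, rhs, ← hamiltonianFlow_apply,
    hflow, add_right_comm]
  rfl

theorem isTrajectory_iff : S.IsTrajectory t₀ tf ρ₀ u ρ ↔
    S.toSkewControlSystem.IsTrajectory u ρ₀ t₀ tf ρ := by
  refine ⟨fun h => ⟨h.1, hasACDeriv_matrix_iff.2 fun i j => ⟨h.2.1 i j, ?_⟩⟩, fun h => ?_⟩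
  · filter_upwards [h.2.2] with t ht
    rw [toSkewControlSystem_velocity]
    exact ht i j
  · have hentry := hasACDeriv_matrix_iff.1 h.hasACDeriv
    refine ⟨h.initial, fun i j => (hentry i j).absolutelyContinuous, ?_⟩
    filter_upwards [ae_all_iff.2 fun i => ae_all_iff.2 fun j => (hentry i j).ae_hasDerivAt]
      with t ht
    simpa only [toSkewControlSystem_velocity] using ht

theorem conjTranspose_dissipator (ρ : CMat N) : (S.dissipator ρ)ᴴ = S.dissipator ρᴴ := by
  simp only [dissipator, Matrix.conjTranspose_sum, Matrix.conjTranspose_smul,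
    Matrix.conjTranspose_sub, Matrix.conjTranspose_add, Matrix.conjTranspose_mul,
    Matrix.conjTranspose_conjTranspose, mul_assoc]
  refine Finset.sum_congr rfl fun k _ => ?_
  simp [add_comm]

theorem isHermitian_of_isTrajectory (hρ₀ : ρ₀.IsHermitian)
    (hρ : S.toSkewControlSystem.IsTrajectory u ρ₀ t₀ tf ρ) {t : ℝ} (ht : t ∈ Icc t₀ tf) :
    (ρ t).IsHermitian :=
  hρ.apply_eq_self (J := (starL' ℝ : CMat N ≃L[ℝ] CMat N).toContinuousLinearMap)
    (fun A => by
      simp [toSkewControlSystem_drift_apply, Matrix.star_eq_conjTranspose,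
        conjTranspose_hamiltonianFlow _ S.H₀_herm, conjTranspose_dissipator])
    (fun s A => conjTranspose_hamiltonianFlow _ (S.Hc_herm s) A) hρ₀ ht

theorem integrableOn_control
    (hHc : ∀ i j, IntegrableOn (fun t => S.Hc t i j) (Icc t₀ tf)) :
    IntegrableOn S.toSkewControlSystem.control (Icc t₀ tf) :=
  (hamiltonianFlow S.hbar).integrable_comp (integrable_of_integrable_entry hHc)

theorem norm_Phi_eq (t : ℝ) {ρ : CMat N} (hρ : ρ.IsHermitian) :
    ‖Phi (S.Hc t) ρ‖ = S.hbar * ‖fderiv ℝ (fun ρ : CMat N => coherence ρ ^ 2) ρ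
      (S.toSkewControlSystem.control t ρ)‖ := by
  rw [Phi_eq_fderiv_coherence_sq S.hbar_pos.ne' (S.Hc_herm t) hρ, Complex.norm_real, norm_mul,
    Real.norm_of_nonneg S.hbar_pos.le]
  rfl

theorem mem_controls_Icc_iff {c d : ℝ} : u ∈ controls t₀ tf (Icc c d) ↔
    AEStronglyMeasurable u (volume.restrict (Icc t₀ tf)) ∧
      ∀ᵐ t ∂volume.restrict (Icc t₀ tf), u t ∈ Icc c d := by
  refine ⟨fun hu => ⟨hu.1.1, hu.2⟩, fun hu => ⟨memLp_top_of_bound hu.1 (max |c| |d|) ?_, hu.2⟩⟩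
  filter_upwards [hu.2] with t ht using abs_le_max_abs_abs ht.1 ht.2

theorem feasibleControls_Icc {α β c d : ℝ} : S.feasibleControls t₀ tf ρ₀ α β (Icc c d) =
    S.toSkewControlSystem.viableControls ρ₀ t₀ tf c d {ρ | coherence ρ ^ 2 ∈ Icc α β} := by
  ext u
  simp only [feasibleControls, SkewControlSystem.viableControls, mem_ofPred_eq,
    mem_controls_Icc_iff, isTrajectory_iff, and_assoc]

theorem controls_mono {Ω Ω' : Set ℝ} (h : Ω ⊆ Ω') : controls t₀ tf Ω ⊆ controls t₀ tf Ω' :=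
  fun _ hu => ⟨hu.1, hu.2.mono fun _ ht => h ht⟩

/- The threshold `ε / (2ℏ)` lies strictly below the gain `|Φ| / ℏ ≥ ε / ℏ`, so the feedback keeps
`C²` at its initial value. -/
theorem exists_forall_feasibleControls_nonempty (ht : t₀ ≤ tf)
    (hHc : ∀ i j, IntegrableOn (fun t => S.Hc t i j) (Icc t₀ tf))
    (hHc_right : ∀ t ∈ Ico t₀ tf, ContinuousWithinAt S.Hc (Ici t) t) (hρ₀ : ρ₀.IsHermitian)
    {α β ε : ℝ} (hC : coherence ρ₀ ^ 2 ∈ Icc α β) (hε : 0 < ε) :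
    ∃ M : ℝ, 0 < M ∧ ∀ Ω : Set ℝ, Icc (-M) M ⊆ Ω → S.PhiBoundedAway t₀ tf ρ₀ α β Ω ε →
      (S.feasibleControls t₀ tf ρ₀ α β Ω).Nonempty := by
  have he : 0 < ε / (2 * S.hbar) := div_pos hε (mul_pos two_pos S.hbar_pos)
  obtain ⟨M, ρ, hρ_cont, hρ, huM⟩ := SkewControlSystem.exists_outputFeedback_trajectory ht
    (integrableOn_control hHc) contDiff_coherence_sq he ρ₀
  have hM : Icc (-M) M ⊆ Icc (-max M 1) (max M 1) :=
    Icc_subset_Icc (neg_le_neg (le_max_left _ _)) (le_max_left _ _)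
  refine ⟨max M 1, one_pos.trans_le (le_max_right _ _), fun Ω hΩ hΦ => ?_⟩
  set u : ℝ → ℝ := fun t => S.toSkewControlSystem.outputFeedback
    (fun ρ : CMat N => coherence ρ ^ 2) (ε / (2 * S.hbar)) t (ρ t)
  have hu_mem : u ∈ controls t₀ tf Ω :=
    controls_mono (hM.trans hΩ) <| mem_controls_Icc_iff.2
      ⟨SkewControlSystem.aestronglyMeasurable_outputFeedback contDiff_coherence_sq
        (integrableOn_control hHc).1 hρ_cont,
      ae_restrict_of_forall_mem measurableSet_Icc fun t ht => abs_le.1 (huM t ht)⟩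
  have hconst := SkewControlSystem.apply_eq_of_outputFeedback contDiff_coherence_sq he
    (fun t ht => (hamiltonianFlow S.hbar).continuous.continuousAt.comp_continuousWithinAt
      (hHc_right t ht)) hρ_cont hρ fun t ht hCt => ?_
  · exact ⟨u, hu_mem, ρ, isTrajectory_iff.2 hρ, fun t ht => (hconst t ht).symm ▸ hC⟩
  · have hgain := hΦ u hu_mem ρ (isTrajectory_iff.2 hρ) t ht fun s hs => (hCt s hs).symm ▸ hC
    rw [norm_Phi_eq t (isHermitian_of_isTrajectory hρ₀ hρ ht)] at hgain
    rw [div_lt_iff₀ (mul_pos two_pos S.hbar_pos)]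
    linarith

theorem exists_isMinOn_controlEnergy (ht : t₀ ≤ tf)
    (hHc : ∀ i j, IntegrableOn (fun t => S.Hc t i j) (Icc t₀ tf)) {α β : ℝ} {Ω : Set ℝ}
    (hΩ : IsCompact Ω) (hΩ_conv : Convex ℝ Ω) (hΩ_ne : Ω.Nonempty)
    (hne : (S.feasibleControls t₀ tf ρ₀ α β Ω).Nonempty) :
    ∃ u ∈ S.feasibleControls t₀ tf ρ₀ α β Ω,
      IsMinOn (controlEnergy t₀ tf) (S.feasibleControls t₀ tf ρ₀ α β Ω) u := by
  have henergy : controlEnergy t₀ tf = fun u => ∫ t in Icc t₀ tf, u t ^ 2 := by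
    ext u
    rw [controlEnergy, intervalIntegral.integral_of_le ht, integral_Icc_eq_integral_Ioc]
  rw [eq_Icc_of_connected_compact ⟨hΩ_ne, hΩ_conv.isPreconnected⟩ hΩ, feasibleControls_Icc] at *
  rw [henergy]
  exact SkewControlSystem.exists_isMinOn_integral_sq ht (integrableOn_control hHc)
    (isClosed_Icc.preimage contDiff_coherence_sq.continuous) hne

end OpenSystem

end Lindblad

theorem proposition1_general {N K : ℕ} (S : OpenSystem N K) (t₀ tf : ℝ) (ht : t₀ ≤ tf)
    (hHc_int : ∀ i j, IntegrableOn (fun t => S.Hc t i j) (Icc t₀ tf))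
    (hHc_right : ∀ t ∈ Ico t₀ tf, ContinuousWithinAt S.Hc (Ici t) t)
    (ρ₀ : CMat N) (hρ₀ : ρ₀.IsHermitian)
    (α β : ℝ) (hC : coherence ρ₀ ^ 2 ∈ Icc α β)
    (ε : ℝ) (hε : 0 < ε) :
    ∃ M : ℝ, 0 < M ∧ ∀ Ω : Set ℝ, Icc (-M) M ⊆ Ω →
      S.PhiBoundedAway t₀ tf ρ₀ α β Ω ε →
        (S.feasibleControls t₀ tf ρ₀ α β Ω).Nonempty ∧
        (IsCompact Ω → Convex ℝ Ω →
          ∃ u ∈ S.feasibleControls t₀ tf ρ₀ α β Ω,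
            IsMinOn (controlEnergy t₀ tf) (S.feasibleControls t₀ tf ρ₀ α β Ω) u) := by
  obtain ⟨M, hM, hfeasible⟩ :=
    OpenSystem.exists_forall_feasibleControls_nonempty ht hHc_int hHc_right hρ₀ hC hε
  refine ⟨M, hM, fun Ω hMΩ hΦ => ⟨hfeasible Ω hMΩ hΦ, fun hΩ hΩ_conv => ?_⟩⟩
  exact OpenSystem.exists_isMinOn_controlEnergy ht hHc_int hΩ hΩ_conv
    ((nonempty_Icc.2 (neg_le_self hM.le)).mono hMΩ) (hfeasible Ω hMΩ hΦ)

theorem proposition1 {N K : ℕ} (S : OpenSystem N K) (t₀ tf : ℝ) (ht : t₀ ≤ tf)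
    (hHc_int : ∀ i j, MeasureTheory.IntegrableOn (fun t => S.Hc t i j) (Set.Icc t₀ tf))
    (hHc_right : ∀ t ∈ Set.Ico t₀ tf, ContinuousWithinAt S.Hc (Set.Ici t) t)
    (ρ₀ : CMat N) (hρ₀ : IsDensityMatrix ρ₀)
    (α β : ℝ) (hC : coherence ρ₀ ^ 2 ∈ Set.Icc α β)
    (ε : ℝ) (hε : 0 < ε) :
    ∃ M : ℝ, 0 < M ∧ ∀ Ω : Set ℝ, Set.Icc (-M) M ⊆ Ω →
      S.PhiBoundedAway t₀ tf ρ₀ α β Ω ε →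
        (S.feasibleControls t₀ tf ρ₀ α β Ω).Nonempty ∧
        (IsCompact Ω → Convex ℝ Ω →
          ∃ u ∈ S.feasibleControls t₀ tf ρ₀ α β Ω,
            IsMinOn (controlEnergy t₀ tf) (S.feasibleControls t₀ tf ρ₀ α β Ω) u) :=
  proposition1_general S t₀ tf ht hHc_int hHc_right ρ₀ hρ₀.1.isHermitian α β hC ε hε
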